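/- All Hilbert spaces are finite-dimensional and nonzero, logarithms are to base $2$. For a bipartite state $\omega_{ST}$ let $I(S{:}T)_\omega := D(\omega_{ST}\,\|\,\omega_S\otimes\omega_T)$ be the quantum mutual information, where $D(\rho\|\sigma)=\operatorname{tr}[\rho(\log\rho-\log\sigma)]$. Let $\mathcal N_{A\to B}$ be a quantum channel (a completely positive trace-preserving linear map). Its Holevo information is $$\chi(\mathcal N):=\max I(X{:}B)_\sigma,\qquad \sigma_{XB}=\sum_x p_X(x)\,|x\rangle\langle x|_X\otimes\mathcal N(\rho_A^x),$$ the maximum being over all probability distributions $p_X$ on finite alphabets and all families of states $\rho_A^x$ of $A$. For a bipartite state $\rho_{E_AE_B}$, its $\rho$-assisted Holevo information and $\rho$-assisted mutual information are $$\chi_\rho(\mathcal N):=\max I(X{:}BE_B)_\omega,\qquad I_\rho(\mathcal N):=\max I(XE_B{:}B)_\omega,$$ both maxima being over all states $$\omega_{XBE_B}=\sum_x p_X(x)\,|x\rangle\langle x|_X\otimes\bigl((\mathcal N_{A\to B}\circ\mathcal E^x_{E_A\to A})\otimes\mathrm{id}_{E_B}\bigr)(\rho_{E_AE_B}),$$ with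 $p_X$ a probability distribution on a finite alphabet and $\mathcal E^x_{E_A\to A}$ quantum channels. Then for every separable state $\rho_{E_AE_B}$ (a finite convex combination of product states $\alpha_{E_A}\otimes\beta_{E_B}$) the three maxima are attained and $$\chi_\rho(\mathcal N)=I_\rho(\mathcal N)=\chi(\mathcal N).$$ -/

import Mathlib

open scoped Kronecker ComplexOrder

noncomputable section

/-! Finite-dimensional quantum systems are represented by finite index types (an orthonormal basis
of the Hilbert space), operators by complex matrices, and composite systems by product types. -/

namespace QInfo

/-- Density operators: positive semidefinite with trace one. -/
def IsState {S : Type*} [Fintype S] (ρ : Matrix S S ℂ) : Prop :=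
  ρ.PosSemidef ∧ ρ.trace = 1

/-- The action of `Φ ⊗ id_R`: the map `Φ` is applied to the first tensor factor. -/
def applyFst {S T R : Type*} (Φ : Matrix S S ℂ →ₗ[ℂ] Matrix T T ℂ)
    (M : Matrix (S × R) (S × R) ℂ) : Matrix (T × R) (T × R) ℂ :=
  Matrix.of fun i j => Φ (Matrix.of fun s s' => M (s, i.2) (s', j.2)) i.1 j.1

/-- Quantum channels: completely positive (positive after tensoring with the identity of every
finite-dimensional reference system) and trace-preserving linear maps. -/
structure IsChannel {S T : Type*} [Fintype S] [Fintype T]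
    (Φ : Matrix S S ℂ →ₗ[ℂ] Matrix T T ℂ) : Prop where
  completelyPositive : ∀ (r : ℕ) (M : Matrix (S × Fin r) (S × Fin r) ℂ),
    M.PosSemidef → (applyFst Φ M).PosSemidef
  tracePreserving : ∀ M : Matrix S S ℂ, (Φ M).trace = M.trace

/-- The partial trace over the second factor. -/
def trSnd {S T : Type*} [Fintype T] (M : Matrix (S × T) (S × T) ℂ) : Matrix S S ℂ :=
  Matrix.of fun s s' => ∑ t, M (s, t) (s', t)

/-- The partial trace over the first factor. -/
def trFst {S T : Type*} [Fintype S] (M : Matrix (S × T) (S × T) ℂ) : Matrix T T ℂ :=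
  Matrix.of fun t t' => ∑ s, M (s, t) (s, t')

/-- The base-2 logarithm of a Hermitian matrix, through the functional calculus. Since
`Real.logb 2 0 = 0`, this is the logarithm on the support and zero on the kernel. -/
def log2 {S : Type*} [Fintype S] [DecidableEq S] (M : Matrix S S ℂ) : Matrix S S ℂ :=
  cfc (Real.logb 2) M

/-- The quantum relative entropy `D(ρ‖σ) = tr [ρ (log ρ - log σ)]` (base 2), for `ρ`, `σ` positive
semidefinite with the support of `ρ` contained in the support of `σ`. -/
def relEntropy {S : Type*} [Fintype S] [DecidableEq S] (ρ σ : Matrix S S ℂ) : ℝ :=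
  (ρ * (log2 ρ - log2 σ)).trace.re

/-- The mutual information `I(S:T)_ω = D(ω_ST ‖ ω_S ⊗ ω_T)`. The support of a state is always
contained in the support of the product of its marginals. -/
def mutualInfo {S T : Type*} [Fintype S] [DecidableEq S] [Fintype T] [DecidableEq T]
    (ω : Matrix (S × T) (S × T) ℂ) : ℝ :=
  relEntropy ω (trSnd ω ⊗ₖ trFst ω)

/-- The classical-quantum operator `∑ x, p x • |x⟩⟨x| ⊗ τ x`. -/
def cqState {X S : Type*} [Fintype X] [DecidableEq X] (p : X → ℝ) (τ : X → Matrix S S ℂ) :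
    Matrix (X × S) (X × S) ℂ :=
  ∑ x, (p x : ℂ) • (Matrix.single x x (1 : ℂ) ⊗ₖ τ x)

/-- Regrouping of the systems `X(BE)` as `(XE)B`. -/
def regroup (X B E : Type*) : X × (B × E) ≃ (X × E) × B where
  toFun i := ((i.1, i.2.2), i.2.1)
  invFun i := (i.1.1, (i.2, i.1.2))
  left_inv _ := rfl
  right_inv _ := rfl

section Information

variable {A B EA EB : Type*} [Fintype A] [DecidableEq A] [Fintype B] [DecidableEq B]
  [Fintype EA] [DecidableEq EA] [Fintype EB] [DecidableEq EB]

/-- All values `I(X:B)_σ`, where `σ_XB = ∑ x, p x • |x⟩⟨x| ⊗ N (ρ x)`, for a probability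
distribution `p` on a finite alphabet and states `ρ x` of `A`. -/
def holevoValues (N : Matrix A A ℂ →ₗ[ℂ] Matrix B B ℂ) : Set ℝ :=
  {v | ∃ (n : ℕ) (p : Fin n → ℝ) (ρ : Fin n → Matrix A A ℂ),
    p ∈ stdSimplex ℝ (Fin n) ∧ (∀ x, IsState (ρ x)) ∧
    v = mutualInfo (cqState p fun x => N (ρ x))}

/-- The Holevo information `χ(N)`. -/
def holevoInfo (N : Matrix A A ℂ →ₗ[ℂ] Matrix B B ℂ) : ℝ := sSup (holevoValues N)

/-- The state `ω_XBE = ∑ x, p x • |x⟩⟨x| ⊗ (N ∘ ℰ x ⊗ id) ρ` produced by the encoding maps `ℰ x` from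
the preshared state `ρ`. -/
def encodedState {n : ℕ} (ρ : Matrix (EA × EB) (EA × EB) ℂ)
    (N : Matrix A A ℂ →ₗ[ℂ] Matrix B B ℂ) (p : Fin n → ℝ)
    (ℰ : Fin n → Matrix EA EA ℂ →ₗ[ℂ] Matrix A A ℂ) :
    Matrix (Fin n × (B × EB)) (Fin n × (B × EB)) ℂ :=
  cqState p fun x => applyFst (N ∘ₗ ℰ x) ρ

/-- All values `I(X:BE)_ω` over distributions on finite alphabets and encoding channels. -/
def assistedHolevoValues (ρ : Matrix (EA × EB) (EA × EB) ℂ)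
    (N : Matrix A A ℂ →ₗ[ℂ] Matrix B B ℂ) : Set ℝ :=
  {v | ∃ (n : ℕ) (p : Fin n → ℝ) (ℰ : Fin n → Matrix EA EA ℂ →ₗ[ℂ] Matrix A A ℂ),
    p ∈ stdSimplex ℝ (Fin n) ∧ (∀ x, IsChannel (ℰ x)) ∧
    v = mutualInfo (encodedState ρ N p ℰ)}

/-- The `ρ`-assisted Holevo information `χ_ρ(N)`. -/
def assistedHolevoInfo (ρ : Matrix (EA × EB) (EA × EB) ℂ)
    (N : Matrix A A ℂ →ₗ[ℂ] Matrix B B ℂ) : ℝ := sSup (assistedHolevoValues ρ N)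

/-- All values `I(XE:B)_ω` over distributions on finite alphabets and encoding channels. -/
def assistedMutualValues (ρ : Matrix (EA × EB) (EA × EB) ℂ)
    (N : Matrix A A ℂ →ₗ[ℂ] Matrix B B ℂ) : Set ℝ :=
  {v | ∃ (n : ℕ) (p : Fin n → ℝ) (ℰ : Fin n → Matrix EA EA ℂ →ₗ[ℂ] Matrix A A ℂ),
    p ∈ stdSimplex ℝ (Fin n) ∧ (∀ x, IsChannel (ℰ x)) ∧
    v = mutualInfo ((encodedState ρ N p ℰ).reindex (regroup (Fin n) B EB)
      (regroup (Fin n) B EB))}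

/-- The `ρ`-assisted mutual information `I_ρ(N)`. -/
def assistedMutualInfo (ρ : Matrix (EA × EB) (EA × EB) ℂ)
    (N : Matrix A A ℂ →ₗ[ℂ] Matrix B B ℂ) : ℝ := sSup (assistedMutualValues ρ N)

/-- Separable states: finite convex combinations of product states. -/
def IsSeparableState (ρ : Matrix (EA × EB) (EA × EB) ℂ) : Prop :=
  ∃ (n : ℕ) (q : Fin n → ℝ) (α : Fin n → Matrix EA EA ℂ) (β : Fin n → Matrix EB EB ℂ),
    q ∈ stdSimplex ℝ (Fin n) ∧ (∀ k, IsState (α k)) ∧ (∀ k, IsState (β k)) ∧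
    ρ = ∑ k, (q k : ℂ) • (α k ⊗ₖ β k)

end Information

end QInfo

end

namespace QInfo

open Matrix Filter Topology


/-! Lower bound: for any shared state the encoders may discard their share and prepare a fresh input
(`replacement`). The other share is then an uncorrelated factor, so every unassisted value is also
an assisted one.

Upper bound: for ρ = ∑ q_k α_k ⊗ β_k the letter x produces ∑ q_k τ_{x,k} ⊗ β_k on BE, with τ_{x,k} =
N(ℰ_x(α_k)). Everything rests on concavity of the conditional entropy S(S|T) = S(ST) - S(T), used in
two ways. For X given BE, S(X|BE) is the Shannon entropy of p minus the Holevo quantity, so the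
latter is at most the q-average of the Holevo quantities of the unassisted ensembles (p_x, τ_{x,k})
(`holevoQuantity_sum_kronecker_le`). For B given E, I(XE:B) = S(B) - ∑ p_x S(B|E)_x, and S(B|E)_x ≥
∑ q_k S(τ_{x,k}), so I(XE:B) is at most the Holevo quantity of the ensemble with letters (x,k)
(`entropy_sub_condEntropy_sum_kronecker_le`).

Concavity comes from S(S|T) = -D(ω ‖ 1 ⊗ ω_T) and joint convexity of D (`relEntropy_add_le`). Up to
a divergence depending only on tr ρ, D is the integral over t ≥ 0 of tr [ρ (L_σ + t R_ρ)⁻¹ ρ], a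
supremum of functionals linear in (ρ, σ). This treats positive definite operators; continuity of the
entropy gives the rest.

Attainment: the Holevo quantity depends only on the average input and the average output entropy, a
point of a compact convex hull (`exists_isGreatest_holevoValues`). -/

/-- The columns of the unitary matrix `U` diagonalize `M`, with real eigenvalues `d`. -/
structure Diagonalizes {n m : Type*} [Fintype n] [Fintype m] [DecidableEq n] [DecidableEq m]
    (M : Matrix n n ℂ) (U : Matrix n m ℂ) (d : m → ℝ) : Prop where
  left : Uᴴ * U = 1
  right : U * Uᴴ = 1
  eq : M = U * diagonal (fun i => (d i : ℂ)) * Uᴴ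

/-- The von Neumann entropy (base 2). -/
noncomputable def entropy {S : Type*} [Fintype S] [DecidableEq S] (M : Matrix S S ℂ) : ℝ :=
  -(M * log2 M).trace.re

/-! ### Functional calculus and entropy in an arbitrary eigenbasis -/

section Diagonalization

variable {n m : Type*} [Fintype n] [Fintype m] [DecidableEq n] [DecidableEq m]
  {n' m' : Type*} [Fintype n'] [Fintype m'] [DecidableEq n'] [DecidableEq m']

theorem exists_diagonalizes {M : Matrix n n ℂ} (hM : M.IsHermitian) :
    Diagonalizes M (hM.eigenvectorUnitary : Matrix n n ℂ) hM.eigenvalues where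
  left := Unitary.coe_star_mul_self hM.eigenvectorUnitary
  right := Unitary.coe_mul_star_self hM.eigenvectorUnitary
  eq := by
    conv_lhs => rw [hM.spectral_theorem]
    rfl

omit [DecidableEq n] in
theorem trace_mul_conj_diagonal (M : Matrix n n ℂ) (U : Matrix n m ℂ) (d : m → ℂ) :
    (M * (U * diagonal d * Uᴴ)).trace = ∑ i, (Uᴴ * M * U) i i * d i := by
  have : (M * (U * diagonal d * Uᴴ)).trace = (Uᴴ * M * U * diagonal d).trace := by
    rw [← Matrix.mul_assoc, Matrix.trace_mul_comm]
    simp only [Matrix.mul_assoc]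
  rw [this]
  simp [Matrix.trace, Matrix.mul_diagonal]

namespace Diagonalizes

variable {M : Matrix n n ℂ} {U : Matrix n m ℂ} {d : m → ℝ}

theorem isHermitian (h : Diagonalizes M U d) : M.IsHermitian := by
  rw [h.eq]
  refine Matrix.isHermitian_mul_mul_conjTranspose U ?_
  rw [Matrix.isHermitian_diagonal_iff]
  intro i
  simp [isSelfAdjoint_iff]

/-- The change of basis `Wᴴ * U` intertwines the two diagonal forms of `M`, so its entries vanish
unless the corresponding eigenvalues agree; hence it also intertwines their images under `f`. This
frees entropy computations from the canonical eigenbasis, which products and block sums do not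
respect. -/
theorem cfc_eq (h : Diagonalizes M U d) (f : ℝ → ℝ) :
    cfc f M = U * diagonal (fun i => (f (d i) : ℂ)) * Uᴴ := by
  have hM := h.isHermitian
  have hW := exists_diagonalizes hM
  have h1 : cfc f M = (hM.eigenvectorUnitary : Matrix n n ℂ) *
      diagonal (fun i => (f (hM.eigenvalues i) : ℂ)) *
      (hM.eigenvectorUnitary : Matrix n n ℂ)ᴴ := by
    rw [hM.cfc_eq]
    rfl
  rw [h1]
  set W := (hM.eigenvectorUnitary : Matrix n n ℂ)
  set l := hM.eigenvalues
  have hC : diagonal (fun i => (l i : ℂ)) * (Wᴴ * U) = (Wᴴ * U) * diagonal (fun i => (d i : ℂ)) := by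
    calc diagonal (fun i => (l i : ℂ)) * (Wᴴ * U)
        = (Wᴴ * W) * diagonal (fun i => (l i : ℂ)) * (Wᴴ * U) := by rw [hW.left, Matrix.one_mul]
      _ = Wᴴ * (W * diagonal (fun i => (l i : ℂ)) * Wᴴ) * U := by simp only [Matrix.mul_assoc]
      _ = Wᴴ * (U * diagonal (fun i => (d i : ℂ)) * Uᴴ) * U := by rw [← hW.eq, ← h.eq]
      _ = (Wᴴ * U) * diagonal (fun i => (d i : ℂ)) * (Uᴴ * U) := by simp only [Matrix.mul_assoc]
      _ = _ := by rw [h.left, Matrix.mul_one]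
  have hC' : diagonal (fun i => (f (l i) : ℂ)) * (Wᴴ * U) =
      (Wᴴ * U) * diagonal (fun i => (f (d i) : ℂ)) := by
    ext i j
    have := congrFun (congrFun hC i) j
    rw [Matrix.diagonal_mul, Matrix.mul_diagonal] at this ⊢
    by_cases hc : (Wᴴ * U) i j = 0
    · simp [hc]
    · rw [mul_comm ((Wᴴ * U) i j)] at this ⊢
      have h2 : l i = d j := by exact_mod_cast mul_right_cancel₀ hc this
      rw [h2]
  calc W * diagonal (fun i => (f (l i) : ℂ)) * Wᴴ
      = W * diagonal (fun i => (f (l i) : ℂ)) * Wᴴ * (U * Uᴴ) := by rw [h.right, Matrix.mul_one]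
    _ = W * (diagonal (fun i => (f (l i) : ℂ)) * (Wᴴ * U)) * Uᴴ := by
        simp only [Matrix.mul_assoc]
    _ = (W * Wᴴ) * U * diagonal (fun i => (f (d i) : ℂ)) * Uᴴ := by
        rw [hC']; simp only [Matrix.mul_assoc]
    _ = _ := by rw [hW.right, Matrix.one_mul]

theorem log2_eq (h : Diagonalizes M U d) :
    log2 M = U * diagonal (fun i => (Real.logb 2 (d i) : ℂ)) * Uᴴ :=
  h.cfc_eq _

theorem conj_eq (h : Diagonalizes M U d) : Uᴴ * M * U = diagonal (fun i => (d i : ℂ)) := by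
  calc Uᴴ * M * U = (Uᴴ * U) * diagonal (fun i => (d i : ℂ)) * (Uᴴ * U) := by
        rw [h.eq]; simp only [Matrix.mul_assoc]
    _ = _ := by rw [h.left, Matrix.one_mul, Matrix.mul_one]

theorem trace_eq (h : Diagonalizes M U d) : M.trace = ∑ i, (d i : ℂ) := by
  rw [h.eq, Matrix.trace_mul_comm, ← Matrix.mul_assoc, h.left, Matrix.one_mul, Matrix.trace_diagonal]

theorem entropy_eq (h : Diagonalizes M U d) : entropy M = -∑ i, d i * Real.logb 2 (d i) := by
  rw [entropy, h.log2_eq, trace_mul_conj_diagonal, h.conj_eq]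
  simp only [diagonal_apply_eq, ← Complex.ofReal_mul, ← Complex.ofReal_sum, Complex.ofReal_re]

theorem posSemidef_iff (h : Diagonalizes M U d) : M.PosSemidef ↔ ∀ i, 0 ≤ d i := by
  constructor
  · intro hM i
    have := (hM.conjTranspose_mul_mul_same U).diag_nonneg (i := i)
    rw [h.conj_eq, diagonal_apply_eq] at this
    exact_mod_cast this
  · intro hd
    rw [h.eq]
    refine PosSemidef.mul_mul_conjTranspose_same (PosSemidef.diagonal fun i => ?_) U
    simpa using hd i

theorem kronecker {N : Matrix n' n' ℂ} {V : Matrix n' m' ℂ} {e : m' → ℝ}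
    (h : Diagonalizes M U d) (h' : Diagonalizes N V e) :
    Diagonalizes (M ⊗ₖ N) (U ⊗ₖ V) (fun k => d k.1 * e k.2) where
  left := by
    rw [conjTranspose_kronecker, ← mul_kronecker_mul, h.left, h'.left, one_kronecker_one]
  right := by
    rw [conjTranspose_kronecker, ← mul_kronecker_mul, h.right, h'.right, one_kronecker_one]
  eq := by
    rw [conjTranspose_kronecker, h.eq, h'.eq, mul_kronecker_mul, mul_kronecker_mul,
      diagonal_kronecker_diagonal]
    simp

theorem smul (h : Diagonalizes M U d) (c : ℝ) :
    Diagonalizes ((c : ℂ) • M) U (fun i => c * d i) where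
  left := h.left
  right := h.right
  eq := by
    have : diagonal (fun i => ((c * d i : ℝ) : ℂ)) = (c : ℂ) • diagonal (fun i => (d i : ℂ)) := by
      rw [← diagonal_smul]
      congr 1
      ext i
      simp
    rw [this, Matrix.mul_smul, Matrix.smul_mul, ← h.eq]

theorem one : Diagonalizes (1 : Matrix n n ℂ) (1 : Matrix n n ℂ) (fun _ => 1) where
  left := by simp
  right := by simp
  eq := by simp

theorem reindex (h : Diagonalizes M U d) (e : n ≃ n') :
    Diagonalizes (M.reindex e e) (U.submatrix e.symm id) d where
  left := by
    rw [conjTranspose_submatrix, Matrix.submatrix_mul_equiv, h.left, Matrix.submatrix_id_id]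
  right := by
    rw [conjTranspose_submatrix, ← Matrix.submatrix_mul (e₂ := id) _ _ _ _ Function.bijective_id,
      h.right, Matrix.submatrix_one_equiv]
  eq := by
    rw [conjTranspose_submatrix, h.eq, Matrix.reindex_apply]
    ext i j
    simp [Matrix.mul_apply, Matrix.submatrix_apply]

end Diagonalizes

theorem cqState_apply {X S : Type*} [Fintype X] [DecidableEq X] (p : X → ℝ)
    (τ : X → Matrix S S ℂ) (i j : X × S) :
    cqState p τ i j = if i.1 = j.1 then (p i.1 : ℂ) * τ i.1 i.2 j.2 else 0 := by
  rw [cqState, Matrix.sum_apply]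
  simp only [Matrix.smul_apply, kroneckerMap_apply, Matrix.single_apply, smul_eq_mul]
  by_cases h : i.1 = j.1
  · rw [if_pos h, Finset.sum_eq_single i.1]
    · simp [h]
    · intro b _ hb
      simp [hb]
    · simp
  · rw [if_neg h]
    refine Finset.sum_eq_zero fun x _ => ?_
    have : ¬ (x = i.1 ∧ x = j.1) := fun hx => h (hx.1.symm.trans hx.2)
    simp [this]

theorem Diagonalizes.cqState {X : Type*} [Fintype X] [DecidableEq X] {p : X → ℝ}
    {τ : X → Matrix n n ℂ} {U : X → Matrix n m ℂ} {d : X → m → ℝ}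
    (h : ∀ x, Diagonalizes (τ x) (U x) (d x)) :
    Diagonalizes (cqState p τ)
      (Matrix.of fun i j : X × _ => if i.1 = j.1 then U i.1 i.2 j.2 else 0)
      (fun k => p k.1 * d k.1 k.2) where
  left := by
    ext ⟨x, i⟩ ⟨y, j⟩
    have := fun x => congrFun (congrFun (h x).left i) j
    simp only [Matrix.mul_apply, conjTranspose_apply, Matrix.one_apply] at this
    by_cases hxy : x = y
    · subst hxy
      simp [Matrix.mul_apply, conjTranspose_apply, Fintype.sum_prod_type, Matrix.one_apply,
        ← this x]
    · simp [Matrix.mul_apply, conjTranspose_apply, Fintype.sum_prod_type, hxy, Ne.symm hxy]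
  right := by
    ext ⟨x, i⟩ ⟨y, j⟩
    have := fun x => congrFun (congrFun (h x).right i) j
    simp only [Matrix.mul_apply, conjTranspose_apply, Matrix.one_apply] at this
    by_cases hxy : x = y
    · subst hxy
      simp [Matrix.mul_apply, conjTranspose_apply, Fintype.sum_prod_type, Matrix.one_apply,
        ← this x]
    · simp [Matrix.mul_apply, conjTranspose_apply, Fintype.sum_prod_type, hxy, Ne.symm hxy]
  eq := by
    ext ⟨x, i⟩ ⟨y, j⟩
    have := congrFun (congrFun (h x).eq i) j
    rw [Matrix.mul_apply] at this
    simp only [conjTranspose_apply, Matrix.mul_diagonal] at this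
    rw [cqState_apply, Matrix.mul_apply]
    simp only [Matrix.mul_diagonal, conjTranspose_apply, Matrix.of_apply, Fintype.sum_prod_type]
    by_cases hxy : x = y
    · subst hxy
      simp [this, Finset.mul_sum]
      refine Finset.sum_congr rfl fun k _ => ?_
      ring
    · simp [hxy, Ne.symm hxy]

end Diagonalization


/-! ### Entropies of composite operators, and mutual information as a sum of entropies -/

section Entropy

variable {S T : Type*} [Fintype S] [DecidableEq S] [Fintype T] [DecidableEq T]

theorem entropy_reindex {M : Matrix S S ℂ} (hM : M.IsHermitian) (e : S ≃ T) :
    entropy (M.reindex e e) = entropy M := by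
  have h := exists_diagonalizes hM
  rw [h.entropy_eq, (h.reindex e).entropy_eq]

theorem entropy_kronecker {M : Matrix S S ℂ} {N : Matrix T T ℂ} (hM : M.IsHermitian)
    (hN : N.IsHermitian) :
    entropy (M ⊗ₖ N) = entropy M * N.trace.re + M.trace.re * entropy N := by
  have h := exists_diagonalizes hM
  have h' := exists_diagonalizes hN
  rw [h.entropy_eq, h'.entropy_eq, (h.kronecker h').entropy_eq, h.trace_eq, h'.trace_eq,
    ← Complex.ofReal_sum, ← Complex.ofReal_sum, Complex.ofReal_re, Complex.ofReal_re,
    Fintype.sum_prod_type, neg_mul, mul_neg, ← neg_add, Finset.sum_mul_sum, Finset.sum_mul_sum,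
    ← Finset.sum_add_distrib]
  simp_rw [← Finset.sum_add_distrib]
  congr 1
  refine Finset.sum_congr rfl fun i _ => Finset.sum_congr rfl fun j _ => ?_
  by_cases hi : hM.eigenvalues i = 0
  · simp [hi]
  by_cases hj : hN.eigenvalues j = 0
  · simp [hj]
  rw [Real.logb_mul hi hj]
  ring

theorem entropy_smul {M : Matrix S S ℂ} (hM : M.IsHermitian) (c : ℝ) :
    entropy ((c : ℂ) • M) = c * entropy M - c * Real.logb 2 c * M.trace.re := by
  have h := exists_diagonalizes hM
  rw [h.entropy_eq, (h.smul c).entropy_eq, h.trace_eq, ← Complex.ofReal_sum, Complex.ofReal_re,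
    mul_neg, Finset.mul_sum, Finset.mul_sum, ← neg_add', ← Finset.sum_add_distrib]
  congr 1
  refine Finset.sum_congr rfl fun i _ => ?_
  by_cases hc : c = 0
  · simp [hc]
  by_cases hi : hM.eigenvalues i = 0
  · simp [hi]
  rw [Real.logb_mul hc hi]
  ring

theorem entropy_cqState {X : Type*} [Fintype X] [DecidableEq X] (p : X → ℝ)
    {τ : X → Matrix S S ℂ} (hτ : ∀ x, (τ x).IsHermitian) :
    entropy (cqState p τ) =
      ∑ x, p x * entropy (τ x) - ∑ x, p x * Real.logb 2 (p x) * (τ x).trace.re := by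
  have h := fun x => exists_diagonalizes (hτ x)
  rw [(Diagonalizes.cqState h).entropy_eq, Fintype.sum_prod_type, ← Finset.sum_sub_distrib,
    ← Finset.sum_neg_distrib]
  refine Finset.sum_congr rfl fun x _ => ?_
  rw [← entropy_smul (hτ x), ((h x).smul (p x)).entropy_eq]

omit [DecidableEq S] in
theorem trace_mul_kronecker_one (ω : Matrix (S × T) (S × T) ℂ) (P : Matrix S S ℂ) :
    (ω * (P ⊗ₖ (1 : Matrix T T ℂ))).trace = (trSnd ω * P).trace := by
  simp only [Matrix.trace, Matrix.diag_apply, Matrix.mul_apply, Fintype.sum_prod_type, trSnd,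
    Matrix.of_apply, kroneckerMap_apply, Matrix.one_apply, Finset.sum_mul]
  refine Finset.sum_congr rfl fun s _ => ?_
  rw [Finset.sum_comm]
  refine Finset.sum_congr rfl fun s' _ => ?_
  simp

omit [DecidableEq T] in
theorem trace_mul_one_kronecker (ω : Matrix (S × T) (S × T) ℂ) (P : Matrix T T ℂ) :
    (ω * ((1 : Matrix S S ℂ) ⊗ₖ P)).trace = (trFst ω * P).trace := by
  simp only [Matrix.trace, Matrix.diag_apply, Matrix.mul_apply, Fintype.sum_prod_type, trFst,
    Matrix.of_apply, kroneckerMap_apply, Matrix.one_apply, Finset.sum_mul]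
  rw [Finset.sum_comm]
  refine Finset.sum_congr rfl fun s _ => ?_
  rw [Finset.sum_comm]
  simp
  rw [Finset.sum_comm]

omit [Fintype S] [DecidableEq S] [DecidableEq T] in
theorem trSnd_eq_sum (ω : Matrix (S × T) (S × T) ℂ) :
    trSnd ω = ∑ t, ω.submatrix (fun s => (s, t)) (fun s => (s, t)) := by
  ext i j
  simp [trSnd, Matrix.sum_apply]

omit [DecidableEq S] [Fintype T] [DecidableEq T] in
theorem trFst_eq_sum (ω : Matrix (S × T) (S × T) ℂ) :
    trFst ω = ∑ s, ω.submatrix (fun t => (s, t)) (fun t => (s, t)) := by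
  ext i j
  simp [trFst, Matrix.sum_apply]

omit [Fintype S] [DecidableEq S] [DecidableEq T] in
theorem posSemidef_trSnd {ω : Matrix (S × T) (S × T) ℂ} (h : ω.PosSemidef) :
    (trSnd ω).PosSemidef := by
  rw [trSnd_eq_sum]
  exact posSemidef_sum _ fun t _ => h.submatrix _

omit [DecidableEq S] [Fintype T] [DecidableEq T] in
theorem posSemidef_trFst {ω : Matrix (S × T) (S × T) ℂ} (h : ω.PosSemidef) :
    (trFst ω).PosSemidef := by
  rw [trFst_eq_sum]
  exact posSemidef_sum _ fun t _ => h.submatrix _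

/-- In a product eigenbasis of the marginals, log (ω_S ⊗ ω_T) splits into a sum of logarithms, and
each summand sees only one marginal of ω. -/
theorem mutualInfo_eq {ω : Matrix (S × T) (S × T) ℂ} (hω : ω.PosSemidef) :
    mutualInfo ω = entropy (trSnd ω) + entropy (trFst ω) - entropy ω := by
  have h := exists_diagonalizes (posSemidef_trSnd hω).isHermitian
  have h' := exists_diagonalizes (posSemidef_trFst hω).isHermitian
  set a := (posSemidef_trSnd hω).isHermitian.eigenvalues
  set b := (posSemidef_trFst hω).isHermitian.eigenvalues
  set U : Matrix S S ℂ := ↑(posSemidef_trSnd hω).isHermitian.eigenvectorUnitary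
  set V : Matrix T T ℂ := ↑(posSemidef_trFst hω).isHermitian.eigenvectorUnitary
  set w : S × T → ℂ := fun k => ((U ⊗ₖ V)ᴴ * ω * (U ⊗ₖ V)) k k with hw
  have hw0 : ∀ k, 0 ≤ w k := fun k =>
    (hω.conjTranspose_mul_mul_same (U ⊗ₖ V)).diag_nonneg
  have hS : ∀ f : S → ℂ, ∑ k : S × T, w k * f k.1 = (trSnd ω * (U * diagonal f * Uᴴ)).trace := by
    intro f
    have hd : diagonal (fun k : S × T => f k.1) = diagonal f ⊗ₖ (1 : Matrix T T ℂ) := by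
      rw [← diagonal_one, diagonal_kronecker_diagonal]
      simp
    have he : (U * diagonal f * Uᴴ) ⊗ₖ (1 : Matrix T T ℂ) =
        (U ⊗ₖ V) * diagonal (fun k : S × T => f k.1) * (U ⊗ₖ V)ᴴ := by
      rw [hd, conjTranspose_kronecker, ← mul_kronecker_mul, ← mul_kronecker_mul, Matrix.mul_one,
        h'.right]
    rw [← trace_mul_kronecker_one, he, trace_mul_conj_diagonal]
  have hT : ∀ f : T → ℂ, ∑ k : S × T, w k * f k.2 = (trFst ω * (V * diagonal f * Vᴴ)).trace := by
    intro f
    have hd : diagonal (fun k : S × T => f k.2) = (1 : Matrix S S ℂ) ⊗ₖ diagonal f := by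
      rw [← diagonal_one, diagonal_kronecker_diagonal]
      simp
    have he : (1 : Matrix S S ℂ) ⊗ₖ (V * diagonal f * Vᴴ) =
        (U ⊗ₖ V) * diagonal (fun k : S × T => f k.2) * (U ⊗ₖ V)ᴴ := by
      rw [hd, conjTranspose_kronecker, ← mul_kronecker_mul, ← mul_kronecker_mul, Matrix.mul_one,
        h.right]
    rw [← trace_mul_one_kronecker, he, trace_mul_conj_diagonal]
  -- The nonnegative weights `w` over a fixed eigenvector of the marginal add up to its eigenvalue.
  -- They therefore vanish on its kernel, where the convention log 0 = 0 would break the product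
  -- rule for the logarithm.
  have hwS : ∀ k : S × T, a k.1 = 0 → w k = 0 := by
    intro k hk
    have h1 := hS (Pi.single k.1 1)
    rw [trace_mul_conj_diagonal, h.conj_eq] at h1
    simp only [Fintype.sum_prod_type_right, Pi.single_apply, diagonal_apply_eq, mul_ite, mul_one,
      mul_zero, Finset.sum_ite_eq', Finset.mem_univ, if_true, hk, Complex.ofReal_zero] at h1
    exact (Finset.sum_eq_zero_iff_of_nonneg fun t _ => hw0 (k.1, t)).1 h1 k.2 (Finset.mem_univ _)
  have hwT : ∀ k : S × T, b k.2 = 0 → w k = 0 := by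
    intro k hk
    have h1 := hT (Pi.single k.2 1)
    rw [trace_mul_conj_diagonal, h'.conj_eq] at h1
    simp only [Fintype.sum_prod_type, Pi.single_apply, diagonal_apply_eq, mul_ite, mul_one,
      mul_zero, Finset.sum_ite_eq', Finset.mem_univ, if_true, hk, Complex.ofReal_zero] at h1
    exact (Finset.sum_eq_zero_iff_of_nonneg fun s _ => hw0 (s, k.2)).1 h1 k.1 (Finset.mem_univ _)
  have key : (ω * log2 (trSnd ω ⊗ₖ trFst ω)).trace =
      (trSnd ω * log2 (trSnd ω)).trace + (trFst ω * log2 (trFst ω)).trace := by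
    rw [(h.kronecker h').log2_eq, h.log2_eq, h'.log2_eq, trace_mul_conj_diagonal, ← hS, ← hT,
      ← Finset.sum_add_distrib]
    refine Finset.sum_congr rfl fun k _ => ?_
    change w k * _ = _
    by_cases hk : a k.1 = 0
    · simp [hwS k hk]
    by_cases hk' : b k.2 = 0
    · simp [hwT k hk']
    rw [Real.logb_mul hk hk']
    push_cast
    ring
  rw [mutualInfo, relEntropy, Matrix.mul_sub, Matrix.trace_sub, key]
  simp only [entropy, Complex.sub_re, Complex.add_re]
  ring

end Entropy


/-! ### From resolvent-type sums to logarithmic sums -/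

/-- The logarithmic sum is a primitive of `∑ w l² / (m + t l)`; its divergence at infinity depends
only on `∑ w l`, so it cancels between expressions of equal trace. -/
theorem tendsto_sum_log {K : Type*} [Fintype K] {w l m : K → ℝ} (hl : ∀ k, 0 < l k) :
    Tendsto (fun T => ∑ k, w k * l k * Real.log (m k + T * l k) - (∑ k, w k * l k) * Real.log T)
      atTop (𝓝 (∑ k, w k * l k * Real.log (l k))) := by
  have h1 : Tendsto (fun T : ℝ => ∑ k, w k * l k * Real.log (m k * T⁻¹ + l k)) atTop
      (𝓝 (∑ k, w k * l k * Real.log (l k))) := by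
    refine tendsto_finsetSum _ fun k _ => Tendsto.const_mul _ ?_
    refine Tendsto.log ?_ (hl k).ne'
    have := (tendsto_inv_atTop_zero (𝕜 := ℝ)).const_mul (m k)
    simpa using this.add_const (l k)
  have hpos : ∀ᶠ T : ℝ in atTop, ∀ k, 0 < m k * T⁻¹ + l k := by
    rw [eventually_all]
    intro k
    have : Tendsto (fun T : ℝ => m k * T⁻¹ + l k) atTop (𝓝 (l k)) := by
      have := (tendsto_inv_atTop_zero (𝕜 := ℝ)).const_mul (m k)
      simpa using this.add_const (l k)
    exact this.eventually (lt_mem_nhds (hl k))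
  refine h1.congr' ?_
  filter_upwards [eventually_gt_atTop 0, hpos] with T hT hp
  rw [Finset.sum_mul, ← Finset.sum_sub_distrib]
  refine Finset.sum_congr rfl fun k _ => ?_
  have : m k + T * l k = T * (m k * T⁻¹ + l k) := by field_simp
  rw [this, Real.log_mul hT.ne' (hp k).ne']
  ring

theorem hasDerivAt_sum_log {K : Type*} [Fintype K] {w l m : K → ℝ} (hl : ∀ k, 0 < l k)
    (hm : ∀ k, 0 < m k) {t : ℝ} (ht : 0 ≤ t) :
    HasDerivAt (fun T => ∑ k, w k * l k * Real.log (m k + T * l k))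
      (∑ k, w k * (l k ^ 2 / (m k + t * l k))) t := by
  refine HasDerivAt.fun_sum fun k _ => ?_
  have hp : m k + t * l k ≠ 0 := (add_pos_of_pos_of_nonneg (hm k) (mul_nonneg ht (hl k).le)).ne'
  have h := (((hasDerivAt_id t).mul_const (l k)).const_add (m k)).log hp
  refine (h.const_mul (w k * l k)).congr_deriv ?_
  simp only [id]
  ring

/-- Integration of `∑ w l² / (m + t l)` over `t` yields `∑ w l (log l - log m)`, so that an
inequality between sums of the former type implies one between sums of the latter. -/
theorem sum_log_le_of_sum_div_le {K K₁ K₂ : Type*} [Fintype K] [Fintype K₁] [Fintype K₂]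
    {w l m : K → ℝ} {w₁ l₁ m₁ : K₁ → ℝ} {w₂ l₂ m₂ : K₂ → ℝ}
    (hl : ∀ k, 0 < l k) (hm : ∀ k, 0 < m k) (hl₁ : ∀ k, 0 < l₁ k) (hm₁ : ∀ k, 0 < m₁ k)
    (hl₂ : ∀ k, 0 < l₂ k) (hm₂ : ∀ k, 0 < m₂ k)
    (htr : ∑ k, w k * l k = ∑ k, w₁ k * l₁ k + ∑ k, w₂ k * l₂ k)
    (hle : ∀ t, 0 ≤ t → ∑ k, w k * (l k ^ 2 / (m k + t * l k)) ≤
      ∑ k, w₁ k * (l₁ k ^ 2 / (m₁ k + t * l₁ k)) + ∑ k, w₂ k * (l₂ k ^ 2 / (m₂ k + t * l₂ k))) :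
    ∑ k, w k * l k * (Real.log (l k) - Real.log (m k)) ≤
      ∑ k, w₁ k * l₁ k * (Real.log (l₁ k) - Real.log (m₁ k)) +
        ∑ k, w₂ k * l₂ k * (Real.log (l₂ k) - Real.log (m₂ k)) := by
  set H : ℝ → ℝ := fun T => ∑ k, w₁ k * l₁ k * Real.log (m₁ k + T * l₁ k) +
    ∑ k, w₂ k * l₂ k * Real.log (m₂ k + T * l₂ k) - ∑ k, w k * l k * Real.log (m k + T * l k)
    with hH
  have hd : ∀ t, 0 ≤ t → HasDerivAt H (∑ k, w₁ k * (l₁ k ^ 2 / (m₁ k + t * l₁ k)) +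
      ∑ k, w₂ k * (l₂ k ^ 2 / (m₂ k + t * l₂ k)) - ∑ k, w k * (l k ^ 2 / (m k + t * l k))) t :=
    fun t ht => ((hasDerivAt_sum_log hl₁ hm₁ ht).add (hasDerivAt_sum_log hl₂ hm₂ ht)).sub
      (hasDerivAt_sum_log hl hm ht)
  -- The claim is the comparison of `H 0`, which carries the terms log m, with the limit of `H` at
  -- infinity, which carries the terms log l.
  have hmono : MonotoneOn H (Set.Ici 0) := by
    refine monotoneOn_of_deriv_nonneg (convex_Ici 0)
      (fun t ht => (hd t ht).continuousAt.continuousWithinAt) ?_ ?_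
    · intro t ht
      rw [interior_Ici] at ht
      exact (hd t (le_of_lt ht)).differentiableAt.differentiableWithinAt
    · intro t ht
      rw [interior_Ici] at ht
      rw [(hd t (le_of_lt ht)).deriv]
      linarith [hle t (le_of_lt ht)]
  have hlim : Tendsto H atTop (𝓝 (∑ k, w₁ k * l₁ k * Real.log (l₁ k) +
      ∑ k, w₂ k * l₂ k * Real.log (l₂ k) - ∑ k, w k * l k * Real.log (l k))) := by
    refine (((tendsto_sum_log (m := m₁) hl₁).add (tendsto_sum_log (m := m₂) hl₂)).sub
      (tendsto_sum_log (m := m) hl)).congr fun T => ?_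
    -- The equality of traces makes the three multiples of log T cancel.
    rw [htr, hH]
    ring
  have h0 := ge_of_tendsto hlim (eventually_atTop.2 ⟨0, fun T hT =>
    hmono Set.self_mem_Ici (Set.mem_Ici.2 hT) hT⟩)
  simp only [hH, zero_mul, add_zero] at h0
  simp only [mul_sub, Finset.sum_sub_distrib]
  linarith


/-! ### Joint convexity of the relative entropy -/

/-- The functional, linear in `(ρ, σ)`, whose supremum over `Y` is `tr [ρ (L_σ + t R_ρ)⁻¹ ρ]`. -/
noncomputable def modularForm {S : Type*} [Fintype S] (t : ℝ) (Y ρ σ : Matrix S S ℂ) : ℝ :=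
  2 * (Yᴴ * ρ).trace.re - (Yᴴ * (σ * Y)).trace.re - t * (Yᴴ * (Y * ρ)).trace.re

section

variable {S : Type*} [Fintype S] [DecidableEq S]

omit [DecidableEq S] in
theorem modularForm_add (t : ℝ) (Y ρ₁ ρ₂ σ₁ σ₂ : Matrix S S ℂ) :
    modularForm t Y (ρ₁ + ρ₂) (σ₁ + σ₂) = modularForm t Y ρ₁ σ₁ + modularForm t Y ρ₂ σ₂ := by
  simp only [modularForm, Matrix.mul_add, Matrix.add_mul, Matrix.trace_add, Complex.add_re]
  ring

/-- In the eigenbases of σ (rows) and ρ (columns), L_σ + t R_ρ is diagonal with entries `m j + t * l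
i`. The form decouples into one scalar quadratic per matrix entry. -/
theorem modularForm_conj {ρ σ U V : Matrix S S ℂ} {l m : S → ℝ} (hρ : Diagonalizes ρ U l)
    (hσ : Diagonalizes σ V m) (t : ℝ) (Z : Matrix S S ℂ) :
    modularForm t (V * Z * Uᴴ) ρ σ = ∑ i, ∑ j, (2 * l i * (star (Z j i) * (Vᴴ * U) j i).re -
      Complex.normSq (Z j i) * (m j + t * l i)) := by
  have h1 : ((V * Z * Uᴴ)ᴴ * ρ).trace =
      (Zᴴ * ((Vᴴ * U) * diagonal (fun i => (l i : ℂ)))).trace := by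
    rw [← hρ.conj_eq]
    calc ((V * Z * Uᴴ)ᴴ * ρ).trace = (U * (Zᴴ * Vᴴ * ρ)).trace := by
          simp only [conjTranspose_mul, conjTranspose_conjTranspose, Matrix.mul_assoc]
      _ = (Zᴴ * Vᴴ * (U * Uᴴ) * ρ * U).trace := by
          rw [Matrix.trace_mul_comm, hρ.right, Matrix.mul_one]
      _ = _ := by simp only [Matrix.mul_assoc]
  have h2 : ((V * Z * Uᴴ)ᴴ * (σ * (V * Z * Uᴴ))).trace =
      (Zᴴ * (diagonal (fun i => (m i : ℂ)) * Z)).trace := by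
    rw [← hσ.conj_eq]
    calc ((V * Z * Uᴴ)ᴴ * (σ * (V * Z * Uᴴ))).trace
        = (U * (Zᴴ * Vᴴ * σ * V * Z * Uᴴ)).trace := by
          simp only [conjTranspose_mul, conjTranspose_conjTranspose, Matrix.mul_assoc]
      _ = (Zᴴ * Vᴴ * σ * V * Z * (Uᴴ * U)).trace := by
          rw [Matrix.trace_mul_comm, ← Matrix.mul_assoc]
      _ = _ := by
          rw [hρ.left, Matrix.mul_one]
          simp only [Matrix.mul_assoc]
  have h3 : ((V * Z * Uᴴ)ᴴ * ((V * Z * Uᴴ) * ρ)).trace =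
      (Zᴴ * (Z * diagonal (fun i => (l i : ℂ)))).trace := by
    rw [← hρ.conj_eq]
    calc ((V * Z * Uᴴ)ᴴ * ((V * Z * Uᴴ) * ρ)).trace
        = (U * (Zᴴ * (Vᴴ * V) * Z * Uᴴ * ρ)).trace := by
          simp only [conjTranspose_mul, conjTranspose_conjTranspose, Matrix.mul_assoc]
      _ = _ := by
          rw [Matrix.trace_mul_comm, hσ.left, Matrix.mul_one]
          simp only [Matrix.mul_assoc]
  have hns : ∀ z : ℂ, star z * z = (Complex.normSq z : ℂ) := fun z => by
    rw [Complex.normSq_eq_conj_mul_self]; rfl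
  rw [modularForm, h1, h2, h3]
  simp only [Matrix.trace, Matrix.diag_apply, Matrix.mul_apply (M := Zᴴ), conjTranspose_apply,
    Matrix.mul_diagonal, Matrix.diagonal_mul, Complex.re_sum, Finset.mul_sum]
  simp only [← Finset.sum_sub_distrib]
  refine Finset.sum_congr rfl fun i _ => Finset.sum_congr rfl fun j _ => ?_
  have e1 : (star (Z j i) * ((Vᴴ * U) j i * (l i : ℂ))).re =
      l i * (star (Z j i) * (Vᴴ * U) j i).re := by
    rw [← mul_assoc, mul_comm, Complex.re_ofReal_mul]
  have e2 : (star (Z j i) * ((m j : ℂ) * Z j i)).re = m j * Complex.normSq (Z j i) := by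
    rw [mul_left_comm, hns, ← Complex.ofReal_mul, Complex.ofReal_re]
  have e3 : (star (Z j i) * (Z j i * (l i : ℂ))).re = l i * Complex.normSq (Z j i) := by
    rw [← mul_assoc, hns, ← Complex.ofReal_mul, Complex.ofReal_re, mul_comm]
  rw [e1, e2, e3]
  ring

/-- Completing the square in z; the maximum is at z = (l / s) c, as `two_mul_re_sub_eq` records. -/
theorem two_mul_re_sub_le (z c : ℂ) (l : ℝ) {s : ℝ} (hs : 0 < s) :
    2 * l * (star z * c).re - Complex.normSq z * s ≤ Complex.normSq c * (l ^ 2 / s) := by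
  have h : 0 ≤ Complex.normSq ((s : ℂ) * z - (l : ℂ) * c) := Complex.normSq_nonneg _
  have h2 : Complex.normSq ((s : ℂ) * z - (l : ℂ) * c) =
      s * (Complex.normSq z * s - 2 * l * (star z * c).re) + Complex.normSq c * l ^ 2 := by
    simp [Complex.normSq_apply]
    ring
  rw [mul_div_assoc', le_div_iff₀ hs]
  nlinarith

theorem two_mul_re_sub_eq (c : ℂ) (l : ℝ) {s : ℝ} (hs : 0 < s) :
    2 * l * (star (((l / s : ℝ) : ℂ) * c) * c).re - Complex.normSq (((l / s : ℝ) : ℂ) * c) * s =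
      Complex.normSq c * (l ^ 2 / s) := by
  simp [Complex.normSq_apply]
  field_simp
  ring

theorem modularForm_le {ρ σ U V : Matrix S S ℂ} {l m : S → ℝ} (hρ : Diagonalizes ρ U l)
    (hσ : Diagonalizes σ V m) (hl : ∀ i, 0 < l i) (hm : ∀ i, 0 < m i) {t : ℝ} (ht : 0 ≤ t)
    (Y : Matrix S S ℂ) :
    modularForm t Y ρ σ ≤ ∑ k : S × S, Complex.normSq ((Vᴴ * U) k.2 k.1) *
      (l k.1 ^ 2 / (m k.2 + t * l k.1)) := by
  have hY : Y = V * (Vᴴ * Y * U) * Uᴴ := by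
    calc Y = (V * Vᴴ) * Y * (U * Uᴴ) := by
          rw [hσ.right, hρ.right, Matrix.one_mul, Matrix.mul_one]
      _ = _ := by simp only [Matrix.mul_assoc]
  rw [hY, modularForm_conj hρ hσ, Fintype.sum_prod_type]
  exact Finset.sum_le_sum fun i _ => Finset.sum_le_sum fun j _ =>
    two_mul_re_sub_le _ _ _ (add_pos_of_pos_of_nonneg (hm j) (mul_nonneg ht (hl i).le))

theorem exists_modularForm_eq {ρ σ U V : Matrix S S ℂ} {l m : S → ℝ} (hρ : Diagonalizes ρ U l)
    (hσ : Diagonalizes σ V m) (hl : ∀ i, 0 < l i) (hm : ∀ i, 0 < m i) {t : ℝ} (ht : 0 ≤ t) :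
    ∃ Y, modularForm t Y ρ σ = ∑ k : S × S, Complex.normSq ((Vᴴ * U) k.2 k.1) *
      (l k.1 ^ 2 / (m k.2 + t * l k.1)) := by
  -- The entrywise maximizer, which is (L_σ + t R_ρ)⁻¹ ρ written in the two eigenbases.
  refine ⟨V * (Matrix.of fun j i => ((l i / (m j + t * l i) : ℝ) : ℂ) * (Vᴴ * U) j i) * Uᴴ, ?_⟩
  rw [modularForm_conj hρ hσ, Fintype.sum_prod_type]
  exact Finset.sum_congr rfl fun i _ => Finset.sum_congr rfl fun j _ =>
    two_mul_re_sub_eq _ _ (add_pos_of_pos_of_nonneg (hm j) (mul_nonneg ht (hl i).le))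

theorem sum_normSq_overlap {U V : Matrix S S ℂ} (hU : Uᴴ * U = 1) (hV : V * Vᴴ = 1) (i : S) :
    ∑ j, Complex.normSq ((Vᴴ * U) j i) = 1 := by
  have h : (Vᴴ * U)ᴴ * (Vᴴ * U) = 1 := by
    calc (Vᴴ * U)ᴴ * (Vᴴ * U) = Uᴴ * (V * Vᴴ) * U := by
          simp only [conjTranspose_mul, conjTranspose_conjTranspose, Matrix.mul_assoc]
      _ = 1 := by rw [hV, Matrix.mul_one, hU]
  have h2 := congrFun (congrFun h i) i
  rw [Matrix.mul_apply, Matrix.one_apply_eq] at h2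
  have h3 : ((∑ j, Complex.normSq ((Vᴴ * U) j i) : ℝ) : ℂ) = 1 := by
    rw [← h2, Complex.ofReal_sum]
    refine Finset.sum_congr rfl fun j _ => ?_
    rw [Complex.normSq_eq_conj_mul_self]
    rfl
  exact_mod_cast h3

theorem sum_overlap_mul {ρ σ U V : Matrix S S ℂ} {l m : S → ℝ} (hρ : Diagonalizes ρ U l)
    (hσ : Diagonalizes σ V m) :
    ∑ k : S × S, Complex.normSq ((Vᴴ * U) k.2 k.1) * l k.1 = ρ.trace.re := by
  rw [Fintype.sum_prod_type, hρ.trace_eq, ← Complex.ofReal_sum, Complex.ofReal_re]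
  refine Finset.sum_congr rfl fun i _ => ?_
  simp only
  rw [← Finset.sum_mul, sum_normSq_overlap hρ.left hσ.right, one_mul]

/-- The squared overlaps of the two eigenbases act as weights, which turns the relative entropy into
the scalar sum treated by `sum_log_le_of_sum_div_le`. -/
theorem relEntropy_eq_sum {ρ σ U V : Matrix S S ℂ} {l m : S → ℝ} (hρ : Diagonalizes ρ U l)
    (hσ : Diagonalizes σ V m) :
    relEntropy ρ σ = (∑ k : S × S, Complex.normSq ((Vᴴ * U) k.2 k.1) * l k.1 *
      (Real.log (l k.1) - Real.log (m k.2))) / Real.log 2 := by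
  have h1 : (ρ * log2 ρ).trace.re = ∑ i, ∑ j, Complex.normSq ((Vᴴ * U) j i) * l i *
      Real.logb 2 (l i) := by
    have := hρ.entropy_eq
    rw [entropy, neg_inj] at this
    rw [this]
    refine Finset.sum_congr rfl fun i _ => ?_
    rw [← Finset.sum_mul, ← Finset.sum_mul, sum_normSq_overlap hρ.left hσ.right, one_mul]
  have h2 : (ρ * log2 σ).trace.re = ∑ i, ∑ j, Complex.normSq ((Vᴴ * U) j i) * l i *
      Real.logb 2 (m j) := by
    have hC : Vᴴ * ρ * V = (Vᴴ * U) * diagonal (fun i => (l i : ℂ)) * (Vᴴ * U)ᴴ := by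
      rw [hρ.eq]
      simp only [conjTranspose_mul, conjTranspose_conjTranspose, Matrix.mul_assoc]
    rw [hσ.log2_eq, trace_mul_conj_diagonal, hC, Finset.sum_comm, Complex.re_sum]
    refine Finset.sum_congr rfl fun j _ => ?_
    rw [mul_comm, Complex.re_ofReal_mul, Matrix.mul_apply, Complex.re_sum, Finset.mul_sum]
    refine Finset.sum_congr rfl fun i _ => ?_
    rw [Matrix.mul_diagonal, conjTranspose_apply]
    have : (Vᴴ * U) j i * (l i : ℂ) * star ((Vᴴ * U) j i) =
        ((Complex.normSq ((Vᴴ * U) j i) * l i : ℝ) : ℂ) := by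
      rw [Complex.ofReal_mul, Complex.normSq_eq_conj_mul_self]
      change _ = star _ * _ * _
      ring
    rw [this, Complex.ofReal_re]
    ring
  rw [relEntropy, Matrix.mul_sub, Matrix.trace_sub, Complex.sub_re, h1, h2,
    Fintype.sum_prod_type, Finset.sum_div, ← Finset.sum_sub_distrib]
  refine Finset.sum_congr rfl fun i _ => ?_
  rw [Finset.sum_div, ← Finset.sum_sub_distrib]
  refine Finset.sum_congr rfl fun j _ => ?_
  simp only [Real.logb]
  ring

/-- Joint convexity of the relative entropy, in homogeneous form. -/
theorem relEntropy_add_le {ρ₁ ρ₂ σ₁ σ₂ : Matrix S S ℂ} (hρ₁ : ρ₁.PosDef) (hρ₂ : ρ₂.PosDef)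
    (hσ₁ : σ₁.PosDef) (hσ₂ : σ₂.PosDef) :
    relEntropy (ρ₁ + ρ₂) (σ₁ + σ₂) ≤ relEntropy ρ₁ σ₁ + relEntropy ρ₂ σ₂ := by
  have hρ := hρ₁.add hρ₂
  have hσ := hσ₁.add hσ₂
  have dρ₁ := exists_diagonalizes hρ₁.isHermitian
  have dρ₂ := exists_diagonalizes hρ₂.isHermitian
  have dσ₁ := exists_diagonalizes hσ₁.isHermitian
  have dσ₂ := exists_diagonalizes hσ₂.isHermitian
  have dρ := exists_diagonalizes hρ.isHermitian
  have dσ := exists_diagonalizes hσ.isHermitian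
  rw [relEntropy_eq_sum dρ dσ, relEntropy_eq_sum dρ₁ dσ₁, relEntropy_eq_sum dρ₂ dσ₂, ← add_div]
  refine div_le_div_of_nonneg_right ?_ (Real.log_nonneg one_le_two)
  refine sum_log_le_of_sum_div_le (fun k => hρ.eigenvalues_pos _) (fun k => hσ.eigenvalues_pos _)
    (fun k => hρ₁.eigenvalues_pos _) (fun k => hσ₁.eigenvalues_pos _)
    (fun k => hρ₂.eigenvalues_pos _) (fun k => hσ₂.eigenvalues_pos _) ?_ ?_
  · rw [sum_overlap_mul dρ dσ, sum_overlap_mul dρ₁ dσ₁, sum_overlap_mul dρ₂ dσ₂,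
      Matrix.trace_add, Complex.add_re]
  · intro t ht
    -- The `Y` optimal for the sums is merely a trial matrix for each summand, and the form is
    -- additive in (ρ, σ).
    obtain ⟨Y, hY⟩ := exists_modularForm_eq dρ dσ hρ.eigenvalues_pos hσ.eigenvalues_pos ht
    rw [← hY, modularForm_add]
    exact add_le_add (modularForm_le dρ₁ dσ₁ hρ₁.eigenvalues_pos hσ₁.eigenvalues_pos ht Y)
      (modularForm_le dρ₂ dσ₂ hρ₂.eigenvalues_pos hσ₂.eigenvalues_pos ht Y)

end


/-! ### Continuity of the entropy and concavity of the conditional entropy -/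

section

variable {S T : Type*} [Fintype S] [DecidableEq S] [Fintype T] [DecidableEq T]

/-- The single function -x log x is continuous at 0, unlike the logarithm; continuity of the entropy
up to singular matrices relies on this form. -/
theorem entropy_eq_trace_cfc {M : Matrix S S ℂ} (hM : M.IsHermitian) :
    entropy M = (cfc (fun x => Real.negMulLog x / Real.log 2) M).trace.re := by
  have h := exists_diagonalizes hM
  rw [h.entropy_eq, h.cfc_eq, Matrix.trace_mul_comm, ← Matrix.mul_assoc, h.left, Matrix.one_mul,
    Matrix.trace_diagonal, ← Complex.ofReal_sum, Complex.ofReal_re, ← Finset.sum_neg_distrib]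
  refine Finset.sum_congr rfl fun i _ => ?_
  rw [Real.negMulLog, Real.logb]
  ring

open scoped Matrix.Norms.L2Operator in
theorem continuousOn_entropy :
    ContinuousOn (entropy : Matrix S S ℂ → ℝ) {M | M.IsHermitian} := by
  have h : ContinuousOn (fun M : Matrix S S ℂ => cfc (fun x => Real.negMulLog x / Real.log 2) M)
      {M | M.IsHermitian} :=
    ContinuousOn.cfc_of_mem_nhdsSet (s := Set.univ) _ Filter.univ_mem continuousOn_id
      (fun M hM => hM) (Real.continuous_negMulLog.div_const _).continuousOn
  have h2 : Continuous fun M : Matrix S S ℂ => M.trace.re :=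
    Complex.continuous_re.comp (continuous_id.matrix_trace)
  exact (h2.comp_continuousOn h).congr fun M hM => entropy_eq_trace_cfc hM

theorem relEntropy_one_kronecker_trFst {ω : Matrix (S × T) (S × T) ℂ} (hω : ω.PosSemidef) :
    relEntropy ω ((1 : Matrix S S ℂ) ⊗ₖ trFst ω) = entropy (trFst ω) - entropy ω := by
  have h := exists_diagonalizes (posSemidef_trFst hω).isHermitian
  have hl : log2 ((1 : Matrix S S ℂ) ⊗ₖ trFst ω) = (1 : Matrix S S ℂ) ⊗ₖ log2 (trFst ω) := by
    rw [((Diagonalizes.one (n := S)).kronecker h).log2_eq, h.log2_eq, conjTranspose_kronecker]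
    have hd : diagonal (fun k : S × T => (Real.logb 2
        (1 * (posSemidef_trFst hω).isHermitian.eigenvalues k.2) : ℂ)) = (1 : Matrix S S ℂ) ⊗ₖ
        diagonal fun k => (Real.logb 2 ((posSemidef_trFst hω).isHermitian.eigenvalues k) : ℂ) := by
      rw [← diagonal_one, diagonal_kronecker_diagonal]
      simp
    rw [hd, ← mul_kronecker_mul, ← mul_kronecker_mul, conjTranspose_one, Matrix.mul_one,
      Matrix.mul_one]
  rw [relEntropy, Matrix.mul_sub, Matrix.trace_sub, Complex.sub_re, hl, trace_mul_one_kronecker,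
    entropy, entropy]
  ring

omit [DecidableEq S] [Fintype T] [DecidableEq T] in
theorem posDef_trFst [Nonempty S] {ω : Matrix (S × T) (S × T) ℂ} (h : ω.PosDef) :
    (trFst ω).PosDef := by
  rw [trFst_eq_sum]
  exact posDef_sum Finset.univ_nonempty fun s _ => h.submatrix (Prod.mk_right_injective s)

omit [DecidableEq S] [Fintype T] [DecidableEq T] in
theorem trFst_add (ω₁ ω₂ : Matrix (S × T) (S × T) ℂ) :
    trFst (ω₁ + ω₂) = trFst ω₁ + trFst ω₂ := by
  ext i j
  simp [trFst, Finset.sum_add_distrib]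

omit [DecidableEq S] [Fintype T] [DecidableEq T] in
theorem trFst_smul (c : ℂ) (ω : Matrix (S × T) (S × T) ℂ) :
    trFst (c • ω) = c • trFst ω := by
  ext i j
  simp [trFst, Finset.mul_sum]

/-- The conditional entropy `S(S|T)`. -/
noncomputable def condEntropy (ω : Matrix (S × T) (S × T) ℂ) : ℝ :=
  entropy ω - entropy (trFst ω)

theorem condEntropy_add_le_of_posDef [Nonempty S] {ω₁ ω₂ : Matrix (S × T) (S × T) ℂ}
    (h₁ : ω₁.PosDef) (h₂ : ω₂.PosDef) :
    condEntropy ω₁ + condEntropy ω₂ ≤ condEntropy (ω₁ + ω₂) := by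
  have h := relEntropy_add_le h₁ h₂ (PosDef.one.kronecker (posDef_trFst h₁))
    (PosDef.one.kronecker (posDef_trFst h₂))
  rw [← kronecker_add, ← trFst_add, relEntropy_one_kronecker_trFst h₁.posSemidef,
    relEntropy_one_kronecker_trFst h₂.posSemidef,
    relEntropy_one_kronecker_trFst (h₁.add h₂).posSemidef] at h
  simp only [condEntropy]
  linarith

omit [DecidableEq S] [Fintype T] [DecidableEq T] in
theorem continuous_trFst : Continuous (trFst : Matrix (S × T) (S × T) ℂ → Matrix T T ℂ) := by
  refine continuous_matrix fun i j => ?_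
  exact continuous_finsetSum _ fun s _ => continuous_id.matrix_elem _ _

theorem continuousOn_condEntropy :
    ContinuousOn (condEntropy : Matrix (S × T) (S × T) ℂ → ℝ) {M | M.PosSemidef} := by
  refine (continuousOn_entropy.mono fun M hM => PosSemidef.isHermitian hM).sub ?_
  exact continuousOn_entropy.comp continuous_trFst.continuousOn
    fun M hM => (posSemidef_trFst hM).isHermitian

/-- Concavity of the conditional entropy, in homogeneous form. -/
theorem condEntropy_add_le [Nonempty S] {ω₁ ω₂ : Matrix (S × T) (S × T) ℂ}
    (h₁ : ω₁.PosSemidef) (h₂ : ω₂.PosSemidef) :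
    condEntropy ω₁ + condEntropy ω₂ ≤ condEntropy (ω₁ + ω₂) := by
  have hlim : ∀ {ω : Matrix (S × T) (S × T) ℂ} (c : ℝ), 0 ≤ c → ω.PosSemidef →
      Tendsto (fun ε : ℝ => condEntropy (ω + ((c * ε : ℝ) : ℂ) • 1)) (𝓝[>] 0)
        (𝓝 (condEntropy ω)) := by
    intro ω c hc hω
    have hcont : Tendsto (fun ε : ℝ => ω + ((c * ε : ℝ) : ℂ) • (1 : Matrix (S × T) (S × T) ℂ))
        (𝓝[>] 0) (𝓝 ω) := by
      have : Continuous fun ε : ℝ =>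
          ω + ((c * ε : ℝ) : ℂ) • (1 : Matrix (S × T) (S × T) ℂ) := by fun_prop
      have := this.tendsto 0
      simp only [mul_zero, Complex.ofReal_zero, zero_smul, add_zero] at this
      exact this.mono_left nhdsWithin_le_nhds
    refine (continuousOn_condEntropy ω hω).tendsto.comp
      (tendsto_nhdsWithin_iff.2 ⟨hcont, ?_⟩)
    filter_upwards [self_mem_nhdsWithin] with ε hε
    refine hω.add (PosSemidef.one.smul ?_)
    exact_mod_cast mul_nonneg hc (le_of_lt hε)
  have e1 := hlim 1 zero_le_one h₁
  have e2 := hlim 1 zero_le_one h₂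
  -- Shifting each summand by ε shifts the sum by 2ε, hence the constant 2.
  have e3 := hlim 2 zero_le_two (h₁.add h₂)
  refine le_of_tendsto_of_tendsto (e1.add e2) e3 ?_
  filter_upwards [self_mem_nhdsWithin] with ε hε
  have hp : ∀ {ω : Matrix (S × T) (S × T) ℂ}, ω.PosSemidef →
      (ω + ((1 * ε : ℝ) : ℂ) • (1 : Matrix (S × T) (S × T) ℂ)).PosDef := by
    intro ω hω
    refine PosDef.posSemidef_add hω (PosDef.one.smul ?_)
    rw [one_mul]
    exact_mod_cast hε
  have h := condEntropy_add_le_of_posDef (hp h₁) (hp h₂)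
  have he : ω₁ + ((1 * ε : ℝ) : ℂ) • (1 : Matrix (S × T) (S × T) ℂ) + (ω₂ + ((1 * ε : ℝ) : ℂ) • 1) =
      ω₁ + ω₂ + ((2 * ε : ℝ) : ℂ) • 1 := by
    push_cast
    module
  rwa [he] at h

omit [DecidableEq S] [DecidableEq T] in
theorem trace_trFst (ω : Matrix (S × T) (S × T) ℂ) : (trFst ω).trace = ω.trace := by
  simp only [Matrix.trace, trFst, Matrix.diag_apply, Matrix.of_apply, Fintype.sum_prod_type]
  exact Finset.sum_comm

omit [DecidableEq S] [DecidableEq T] in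
theorem trace_trSnd (ω : Matrix (S × T) (S × T) ℂ) : (trSnd ω).trace = ω.trace := by
  simp only [Matrix.trace, trSnd, Matrix.diag_apply, Matrix.of_apply, Fintype.sum_prod_type]

/-- The c log c terms cancel because ω and its marginal have the same trace. Homogeneity turns
superadditivity into concavity. -/
theorem condEntropy_smul {ω : Matrix (S × T) (S × T) ℂ} (hω : ω.PosSemidef) (c : ℝ) :
    condEntropy ((c : ℂ) • ω) = c * condEntropy ω := by
  rw [condEntropy, condEntropy, trFst_smul, entropy_smul hω.isHermitian,
    entropy_smul (posSemidef_trFst hω).isHermitian, trace_trFst]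
  ring

theorem sum_condEntropy_le [Nonempty S] {K : Type*} (s : Finset K) {q : K → ℝ}
    (hq : ∀ k, 0 ≤ q k) {ω : K → Matrix (S × T) (S × T) ℂ} (hω : ∀ k, (ω k).PosSemidef) :
    ∑ k ∈ s, q k * condEntropy (ω k) ≤ condEntropy (∑ k ∈ s, (q k : ℂ) • ω k) := by
  classical
  have hp : ∀ k, ((q k : ℂ) • ω k).PosSemidef := fun k =>
    (hω k).smul (by exact_mod_cast hq k)
  induction s using Finset.induction_on with
  | empty =>
    have := condEntropy_smul (ω := (0 : Matrix (S × T) (S × T) ℂ)) PosSemidef.zero 0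
    simp at this
    simp [this]
  | insert a s ha ih =>
    rw [Finset.sum_insert ha, Finset.sum_insert ha, ← condEntropy_smul (hω a)]
    exact (add_le_add_right ih _).trans
      (condEntropy_add_le (hp a) (posSemidef_sum _ fun k _ => hp k))

end


/-! ### Compactness of convex hulls and of the set of states -/

section Convexity

theorem isCompact_convexHull {E : Type*} [AddCommGroup E] [Module ℝ E] [TopologicalSpace E]
    [ContinuousAdd E] [ContinuousSMul ℝ E] [FiniteDimensional ℝ E] {s : Set E}
    (hs : IsCompact s) : IsCompact (convexHull ℝ s) := by
  -- Carathéodory: at most `finrank + 1` points are needed, so `m` ranges below `finrank + 2`, and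
  -- the hull is a finite union of continuous images of compact sets.
  have h : convexHull ℝ s = ⋃ m ∈ Finset.range (Module.finrank ℝ E + 2),
      (fun a : (Fin m → ℝ) × (Fin m → E) => ∑ i, a.1 i • a.2 i) ''
        (stdSimplex ℝ (Fin m) ×ˢ Set.pi Set.univ fun _ => s) := by
    ext x
    simp only [Set.mem_iUnion, Set.mem_image, Set.mem_prod, Set.mem_pi, Set.mem_univ,
      true_implies, Finset.mem_range]
    constructor
    · intro hx
      obtain ⟨ι, _, z, w, hz, hind, hw, hw1, rfl⟩ := eq_pos_convex_span_of_mem_convexHull hx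
      let e := Fintype.equivFin ι
      have hcard : Fintype.card ι < Module.finrank ℝ E + 2 := by
        have h1 := hind.card_le_finrank_succ
        have h2 := Submodule.finrank_le (vectorSpan ℝ (Set.range z))
        omega
      refine ⟨Fintype.card ι, hcard, (w ∘ e.symm, z ∘ e.symm), ⟨⟨fun i => (hw _).le, ?_⟩,
        fun i => hz ⟨_, rfl⟩⟩, ?_⟩
      · rw [← hw1]
        exact e.symm.sum_comp w
      · exact e.symm.sum_comp fun i => w i • z i
    · rintro ⟨m, _, ⟨w, z⟩, ⟨hw, hz⟩, rfl⟩
      exact mem_convexHull_of_exists_fintype w z hw.1 hw.2 hz rfl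
  rw [h]
  refine (Finset.range _).isCompact_biUnion fun m _ => ?_
  refine ((isCompact_stdSimplex ℝ (Fin m)).prod (isCompact_univ_pi fun _ => hs)).image ?_
  fun_prop

theorem norm_apply_le_one_of_trace {S : Type*} [Fintype S] {X : Matrix S S ℂ}
    (hX : (Xᴴ * X).trace = 1) (i j : S) : ‖X i j‖ ≤ 1 := by
  have h1 : (Xᴴ * X).trace = ((∑ j, ∑ i, Complex.normSq (X i j) : ℝ) : ℂ) := by
    simp only [Matrix.trace, Matrix.diag_apply, Matrix.mul_apply, conjTranspose_apply,
      Complex.ofReal_sum, Complex.normSq_eq_conj_mul_self]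
    rfl
  have h2 : ∑ j, ∑ i, Complex.normSq (X i j) = 1 := by
    rw [h1] at hX
    exact_mod_cast hX
  have h3 : Complex.normSq (X i j) ≤ 1 := by
    rw [← h2]
    refine le_trans ?_ (Finset.single_le_sum (f := fun j => ∑ i, Complex.normSq (X i j))
      (fun j _ => Finset.sum_nonneg fun i _ => Complex.normSq_nonneg _) (Finset.mem_univ j))
    exact Finset.single_le_sum (f := fun i => Complex.normSq (X i j))
      (fun i _ => Complex.normSq_nonneg _) (Finset.mem_univ i)
  rw [Complex.normSq_eq_norm_sq] at h3
  exact (sq_le_one_iff₀ (norm_nonneg _)).1 h3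

open scoped MatrixOrder Matrix.Norms.L2Operator in
-- States are the image of the compact Hilbert–Schmidt unit sphere under X ↦ Xᴴ X.
theorem isCompact_setOf_isState {S : Type*} [Fintype S] [DecidableEq S] :
    IsCompact {ρ : Matrix S S ℂ | IsState ρ} := by
  have hc : Continuous fun X : Matrix S S ℂ => Xᴴ * X := by fun_prop
  have hball : IsCompact (Set.pi Set.univ fun _ : S => Set.pi Set.univ fun _ : S =>
      Metric.closedBall (0 : ℂ) 1) :=
    isCompact_univ_pi fun _ => isCompact_univ_pi fun _ => isCompact_closedBall _ _
  have hK : IsCompact {X : Matrix S S ℂ | (Xᴴ * X).trace = 1} := by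
    exact hball.of_isClosed_subset (isClosed_eq hc.matrix_trace continuous_const)
      fun X hX i _ j _ => mem_closedBall_zero_iff.2 (norm_apply_le_one_of_trace hX i j)
  convert hK.image hc using 1
  ext ρ
  constructor
  · rintro ⟨hρ, htr⟩
    obtain ⟨X, rfl⟩ := CStarAlgebra.nonneg_iff_eq_star_mul_self.mp hρ.nonneg
    exact ⟨X, htr, rfl⟩
  · rintro ⟨X, hX, rfl⟩
    exact ⟨posSemidef_conjTranspose_mul_self X, hX⟩

theorem exists_isState (S : Type*) [Fintype S] [DecidableEq S] [Nonempty S] :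
    ∃ ρ : Matrix S S ℂ, IsState ρ := by
  obtain ⟨s⟩ := ‹Nonempty S›
  refine ⟨diagonal (Pi.single s 1), PosSemidef.diagonal (Pi.single_nonneg.2 zero_le_one), ?_⟩
  simp [Matrix.trace_diagonal]

end Convexity

/-! ### Classical-quantum states and the Holevo quantity -/

section ClassicalQuantum

variable {X S T : Type*} [Fintype X] [DecidableEq X] [Fintype S] [DecidableEq S] [Fintype T]
  [DecidableEq T]

omit [DecidableEq S] in
theorem IsState.isHermitian {ρ : Matrix S S ℂ} (h : IsState ρ) : ρ.IsHermitian := h.1.isHermitian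

omit [DecidableEq S] [DecidableEq T] in
theorem IsState.kronecker {ρ : Matrix S S ℂ} {σ : Matrix T T ℂ} (h : IsState ρ) (h' : IsState σ) :
    IsState (ρ ⊗ₖ σ) :=
  ⟨h.1.kronecker h'.1, by rw [trace_kronecker, h.2, h'.2, one_mul]⟩

omit [DecidableEq S] in
theorem IsState.sum {ι : Type*} [Fintype ι] {p : ι → ℝ} (hp : p ∈ stdSimplex ℝ ι)
    {τ : ι → Matrix S S ℂ} (hτ : ∀ x, IsState (τ x)) : IsState (∑ x, (p x : ℂ) • τ x) := by
  refine ⟨posSemidef_sum _ fun x _ => (hτ x).1.smul (by exact_mod_cast hp.1 x), ?_⟩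
  simp only [Matrix.trace_sum, Matrix.trace_smul, (hτ _).2, smul_eq_mul, mul_one]
  exact_mod_cast hp.2

omit [DecidableEq S] [DecidableEq T] in
theorem IsState.trFst {ω : Matrix (S × T) (S × T) ℂ} (h : IsState ω) : IsState (trFst ω) :=
  ⟨posSemidef_trFst h.1, by rw [trace_trFst, h.2]⟩

omit [DecidableEq S] [DecidableEq T] in
theorem IsState.trSnd {ω : Matrix (S × T) (S × T) ℂ} (h : IsState ω) : IsState (trSnd ω) :=
  ⟨posSemidef_trSnd h.1, by rw [trace_trSnd, h.2]⟩

theorem entropy_kronecker_isState {ρ : Matrix S S ℂ} {σ : Matrix T T ℂ} (h : IsState ρ)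
    (h' : IsState σ) : entropy (ρ ⊗ₖ σ) = entropy ρ + entropy σ := by
  rw [entropy_kronecker h.isHermitian h'.isHermitian, h.2, h'.2]
  simp

omit [DecidableEq S] [Fintype T] [DecidableEq T] in
theorem trFst_kronecker {ρ : Matrix S S ℂ} (σ : Matrix T T ℂ) (h : IsState ρ) :
    trFst (ρ ⊗ₖ σ) = σ := by
  ext i j
  have := h.2
  simp only [Matrix.trace, Matrix.diag_apply] at this
  simp [QInfo.trFst, ← Finset.sum_mul, this]

omit [Fintype S] [DecidableEq S] [DecidableEq T] in
theorem trSnd_kronecker (ρ : Matrix S S ℂ) {σ : Matrix T T ℂ} (h : IsState σ) :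
    trSnd (ρ ⊗ₖ σ) = ρ := by
  ext i j
  have := h.2
  simp only [Matrix.trace, Matrix.diag_apply] at this
  simp [QInfo.trSnd, ← Finset.mul_sum, this]

omit [Fintype S] [DecidableEq S] in
theorem trFst_cqState (p : X → ℝ) (τ : X → Matrix S S ℂ) :
    trFst (cqState p τ) = ∑ x, (p x : ℂ) • τ x := by
  ext i j
  simp [trFst, cqState_apply, Matrix.sum_apply]

omit [DecidableEq S] in
theorem trSnd_cqState (p : X → ℝ) {τ : X → Matrix S S ℂ} (hτ : ∀ x, IsState (τ x)) :
    trSnd (cqState p τ) = diagonal fun x => (p x : ℂ) := by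
  ext x y
  have := (hτ x).2
  simp only [Matrix.trace, Matrix.diag_apply] at this
  simp only [trSnd, cqState_apply, Matrix.of_apply, diagonal_apply]
  split_ifs with h
  · rw [← Finset.mul_sum, this, mul_one]
  · simp

theorem posSemidef_cqState {p : X → ℝ} (hp : ∀ x, 0 ≤ p x) {τ : X → Matrix S S ℂ}
    (hτ : ∀ x, (τ x).PosSemidef) : (cqState p τ).PosSemidef := by
  rw [(Diagonalizes.cqState fun x => exists_diagonalizes (hτ x).isHermitian).posSemidef_iff]
  exact fun k => mul_nonneg (hp _) ((hτ _).eigenvalues_nonneg _)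

/-- The Shannon entropy (base 2). -/
noncomputable def shannonEntropy (p : X → ℝ) : ℝ := -∑ x, p x * Real.logb 2 (p x)

/-- The Holevo quantity of an ensemble. -/
noncomputable def holevoQuantity (p : X → ℝ) (τ : X → Matrix S S ℂ) : ℝ :=
  entropy (∑ x, (p x : ℂ) • τ x) - ∑ x, p x * entropy (τ x)

theorem entropy_cqState_isState (p : X → ℝ) {τ : X → Matrix S S ℂ} (hτ : ∀ x, IsState (τ x)) :
    entropy (cqState p τ) = shannonEntropy p + ∑ x, p x * entropy (τ x) := by
  rw [entropy_cqState p fun x => (hτ x).isHermitian, shannonEntropy]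
  simp only [(hτ _).2, Complex.one_re, mul_one]
  ring

theorem condEntropy_cqState (p : X → ℝ) {τ : X → Matrix S S ℂ} (hτ : ∀ x, IsState (τ x)) :
    condEntropy (cqState p τ) = shannonEntropy p - holevoQuantity p τ := by
  rw [condEntropy, entropy_cqState_isState p hτ, trFst_cqState, holevoQuantity]
  ring

theorem mutualInfo_cqState {p : X → ℝ} (hp : ∀ x, 0 ≤ p x) {τ : X → Matrix S S ℂ}
    (hτ : ∀ x, IsState (τ x)) : mutualInfo (cqState p τ) = holevoQuantity p τ := by
  have hd : Diagonalizes (diagonal fun x => (p x : ℂ)) (1 : Matrix X X ℂ) p :=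
    ⟨by simp, by simp, by simp⟩
  rw [mutualInfo_eq (posSemidef_cqState hp fun x => (hτ x).1), entropy_cqState_isState p hτ,
    trSnd_cqState p hτ, trFst_cqState, hd.entropy_eq, holevoQuantity, shannonEntropy]
  ring

/-- Since X is classical, its Shannon entropy enters both S(XE) and S(XEB) and cancels, leaving S(B)
minus the averaged S(B|E). -/
theorem mutualInfo_regroup_cqState {p : X → ℝ} (hp : ∀ x, 0 ≤ p x)
    {τ : X → Matrix (S × T) (S × T) ℂ} (hτ : ∀ x, IsState (τ x)) :
    mutualInfo ((cqState p τ).reindex (regroup X S T) (regroup X S T)) =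
      entropy (∑ x, (p x : ℂ) • trSnd (τ x)) - ∑ x, p x * condEntropy (τ x) := by
  have hpos := posSemidef_cqState hp fun x => (hτ x).1
  have h1 : trSnd ((cqState p τ).reindex (regroup X S T) (regroup X S T)) =
      cqState p fun x => trFst (τ x) := by
    ext i j
    simp only [trSnd, trFst, cqState_apply, Matrix.of_apply, Matrix.reindex_apply,
      Matrix.submatrix_apply, regroup, Equiv.coe_fn_symm_mk]
    split_ifs with h
    · rw [Finset.mul_sum]
    · simp
  have h2 : trFst ((cqState p τ).reindex (regroup X S T) (regroup X S T)) =
      ∑ x, (p x : ℂ) • trSnd (τ x) := by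
    ext i j
    simp [trSnd, trFst, cqState_apply, Matrix.reindex_apply, regroup, Fintype.sum_prod_type,
      Matrix.sum_apply, Finset.mul_sum]
  have hpos' : ((cqState p τ).reindex (regroup X S T) (regroup X S T)).PosSemidef :=
    hpos.submatrix _
  rw [mutualInfo_eq hpos', h1, h2,
    entropy_reindex hpos.isHermitian, entropy_cqState_isState p hτ,
    entropy_cqState_isState p fun x => (hτ x).trFst]
  simp only [condEntropy, mul_sub, Finset.sum_sub_distrib]
  ring

omit [DecidableEq X] in
theorem holevoQuantity_kronecker {p : X → ℝ} (hp : p ∈ stdSimplex ℝ X) {τ : X → Matrix S S ℂ}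
    (hτ : ∀ x, IsState (τ x)) {β : Matrix T T ℂ} (hβ : IsState β) :
    holevoQuantity p (fun x => τ x ⊗ₖ β) = holevoQuantity p τ := by
  have h : ∑ x, (p x : ℂ) • (τ x ⊗ₖ β) = (∑ x, (p x : ℂ) • τ x) ⊗ₖ β := by
    ext i j
    simp [Matrix.sum_apply, Finset.sum_mul, mul_assoc]
  rw [holevoQuantity, h, entropy_kronecker_isState (IsState.sum hp hτ) hβ, holevoQuantity]
  simp only [entropy_kronecker_isState (hτ _) hβ, mul_add, Finset.sum_add_distrib,
    ← Finset.sum_mul, hp.2]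
  ring

end ClassicalQuantum


/-! ### Bounds for mixtures of product states -/

section Separable

variable {X K S T : Type*} [Fintype X] [DecidableEq X] [Fintype K] [Fintype S] [DecidableEq S]
  [Fintype T] [DecidableEq T]

omit [DecidableEq S] in
theorem IsState.nonempty {ρ : Matrix S S ℂ} (h : IsState ρ) : Nonempty S := by
  by_contra hS
  rw [not_nonempty_iff] at hS
  simpa [Matrix.trace] using h.2

omit [DecidableEq X] in
theorem nonempty_of_mem_stdSimplex {p : X → ℝ} (hp : p ∈ stdSimplex ℝ X) : Nonempty X := by
  by_contra hX
  rw [not_nonempty_iff] at hX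
  simpa using hp.2

omit [Fintype S] [DecidableEq S] in
theorem cqState_sum_smul (p : X → ℝ) (q : K → ℝ) (ω : K → X → Matrix S S ℂ) :
    cqState p (fun x => ∑ k, (q k : ℂ) • ω k x) = ∑ k, (q k : ℂ) • cqState p (ω k) := by
  ext i j
  simp only [cqState_apply, Matrix.sum_apply, Matrix.smul_apply, smul_eq_mul]
  split_ifs with h
  · rw [Finset.mul_sum]
    exact Finset.sum_congr rfl fun k _ => by ring
  · simp

/-- Discarding the label `k` of the states `τ x k ⊗ β k` does not increase the information that
these carry about `x`. -/
theorem holevoQuantity_sum_kronecker_le {p : X → ℝ} (hp : p ∈ stdSimplex ℝ X) {q : K → ℝ}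
    (hq : q ∈ stdSimplex ℝ K) {τ : X → K → Matrix S S ℂ} (hτ : ∀ x k, IsState (τ x k))
    {β : K → Matrix T T ℂ} (hβ : ∀ k, IsState (β k)) :
    holevoQuantity p (fun x => ∑ k, (q k : ℂ) • (τ x k ⊗ₖ β k)) ≤
      ∑ k, q k * holevoQuantity p fun x => τ x k := by
  have : Nonempty X := nonempty_of_mem_stdSimplex hp
  have hs : ∀ k x, IsState (τ x k ⊗ₖ β k) := fun k x => (hτ x k).kronecker (hβ k)
  have h := sum_condEntropy_le Finset.univ hq.1
    fun k => posSemidef_cqState hp.1 fun x => (hs k x).1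
  -- The distribution `p` does not depend on `k`, so its Shannon entropy appears equally on both
  -- sides and drops out.
  rw [← cqState_sum_smul, condEntropy_cqState p fun x => IsState.sum hq fun k => hs k x] at h
  simp only [condEntropy_cqState p (hs _), holevoQuantity_kronecker hp (fun x => hτ x _) (hβ _),
    mul_sub, Finset.sum_sub_distrib, ← Finset.sum_mul, hq.2] at h
  linarith

theorem condEntropy_kronecker {ρ : Matrix S S ℂ} {σ : Matrix T T ℂ} (h : IsState ρ)
    (h' : IsState σ) : condEntropy (ρ ⊗ₖ σ) = entropy ρ := by
  rw [condEntropy, trFst_kronecker σ h, entropy_kronecker_isState h h']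
  ring

theorem le_condEntropy_sum_kronecker {q : K → ℝ} (hq : q ∈ stdSimplex ℝ K)
    {τ : K → Matrix S S ℂ} (hτ : ∀ k, IsState (τ k)) {β : K → Matrix T T ℂ}
    (hβ : ∀ k, IsState (β k)) :
    ∑ k, q k * entropy (τ k) ≤ condEntropy (∑ k, (q k : ℂ) • (τ k ⊗ₖ β k)) := by
  classical
  obtain ⟨k⟩ := nonempty_of_mem_stdSimplex hq
  have : Nonempty S := (hτ k).nonempty
  have h := sum_condEntropy_le Finset.univ hq.1 fun k => ((hτ k).kronecker (hβ k)).1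
  simpa only [condEntropy_kronecker (hτ _) (hβ _)] using h

omit [Fintype S] [DecidableEq S] [DecidableEq T] in
theorem trSnd_sum_smul_kronecker (q : K → ℝ) (τ : K → Matrix S S ℂ) {β : K → Matrix T T ℂ}
    (hβ : ∀ k, IsState (β k)) :
    trSnd (∑ k, (q k : ℂ) • (τ k ⊗ₖ β k)) = ∑ k, (q k : ℂ) • τ k := by
  have h : ∑ k, (q k : ℂ) • τ k = ∑ k, (q k : ℂ) • trSnd (τ k ⊗ₖ β k) := by
    simp only [trSnd_kronecker _ (hβ _)]
  rw [h]
  ext i j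
  simp only [trSnd, Matrix.sum_apply, Matrix.of_apply, Matrix.smul_apply, smul_eq_mul,
    Finset.mul_sum]
  exact Finset.sum_comm

omit [DecidableEq X] in
theorem mul_mem_stdSimplex {p : X → ℝ} (hp : p ∈ stdSimplex ℝ X) {q : K → ℝ}
    (hq : q ∈ stdSimplex ℝ K) : (fun i : X × K => p i.1 * q i.2) ∈ stdSimplex ℝ (X × K) := by
  refine ⟨fun i => mul_nonneg (hp.1 _) (hq.1 _), ?_⟩
  rw [Fintype.sum_prod_type]
  simp only [← Finset.mul_sum, hq.2, mul_one, hp.2]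

omit [DecidableEq X] in
/-- Retaining the label `k` instead of the system in state `β k` does not decrease the
information about the system in state `τ x k`. -/
theorem entropy_sub_condEntropy_sum_kronecker_le {p : X → ℝ} (hp : p ∈ stdSimplex ℝ X)
    {q : K → ℝ} (hq : q ∈ stdSimplex ℝ K) {τ : X → K → Matrix S S ℂ}
    (hτ : ∀ x k, IsState (τ x k)) {β : K → Matrix T T ℂ} (hβ : ∀ k, IsState (β k)) :
    entropy (∑ x, (p x : ℂ) • trSnd (∑ k, (q k : ℂ) • (τ x k ⊗ₖ β k))) -
        ∑ x, p x * condEntropy (∑ k, (q k : ℂ) • (τ x k ⊗ₖ β k)) ≤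
      holevoQuantity (fun i : X × K => p i.1 * q i.2) fun i => τ i.1 i.2 := by
  have h : ∑ x, (p x : ℂ) • trSnd (∑ k, (q k : ℂ) • (τ x k ⊗ₖ β k)) =
      ∑ i : X × K, ((p i.1 * q i.2 : ℝ) : ℂ) • τ i.1 i.2 := by
    rw [Fintype.sum_prod_type]
    simp only [trSnd_sum_smul_kronecker q _ hβ, Finset.smul_sum, smul_smul, Complex.ofReal_mul]
  rw [holevoQuantity, h]
  refine sub_le_sub_left ?_ _
  rw [Fintype.sum_prod_type]
  refine Finset.sum_le_sum fun x _ => ?_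
  simp only [mul_assoc, ← Finset.mul_sum]
  exact mul_le_mul_of_nonneg_left (le_condEntropy_sum_kronecker hq (hτ x) hβ) (hp.1 x)

end Separable

/-! ### Channels acting on one factor, and replacement channels -/

section Channels

variable {A B EA EB : Type*}

theorem applyFst_kronecker (Φ : Matrix A A ℂ →ₗ[ℂ] Matrix B B ℂ) (α : Matrix A A ℂ)
    (β : Matrix EB EB ℂ) : applyFst Φ (α ⊗ₖ β) = Φ α ⊗ₖ β := by
  ext i j
  have : (Matrix.of fun s s' => (α ⊗ₖ β) (s, i.2) (s', j.2)) = β i.2 j.2 • α := by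
    ext s s'
    simp [mul_comm]
  simp only [applyFst, Matrix.of_apply]
  rw [this, map_smul]
  simp [mul_comm]

theorem applyFst_sum_smul {K : Type*} [Fintype K] (Φ : Matrix A A ℂ →ₗ[ℂ] Matrix B B ℂ)
    (q : K → ℂ) (M : K → Matrix (A × EB) (A × EB) ℂ) :
    applyFst Φ (∑ k, q k • M k) = ∑ k, q k • applyFst Φ (M k) := by
  ext i j
  have : (Matrix.of fun s s' => (∑ k, q k • M k) (s, i.2) (s', j.2)) =
      ∑ k, q k • Matrix.of fun s s' => M k (s, i.2) (s', j.2) := by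
    ext s s'
    simp [Matrix.sum_apply]
  simp only [applyFst, Matrix.of_apply]
  rw [this, map_sum]
  simp only [map_smul, Matrix.sum_apply, Matrix.smul_apply, Matrix.of_apply]

variable [Fintype A] [Fintype B] [Fintype EA]

theorem IsChannel.isState {Φ : Matrix A A ℂ →ₗ[ℂ] Matrix B B ℂ} (hΦ : IsChannel Φ)
    {α : Matrix A A ℂ} (hα : IsState α) : IsState (Φ α) := by
  refine ⟨?_, by rw [hΦ.tracePreserving, hα.2]⟩
  -- Plain positivity is complete positivity with a one-dimensional reference system.
  have h := hΦ.completelyPositive 1 (α ⊗ₖ (1 : Matrix (Fin 1) (Fin 1) ℂ))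
    (hα.1.kronecker PosSemidef.one)
  rw [applyFst_kronecker] at h
  convert h.submatrix fun b => (b, (0 : Fin 1)) using 1
  ext i j
  simp

/-- The channel that discards its input and prepares the state `σ`. -/
def replacement (EA : Type*) [Fintype EA] (σ : Matrix A A ℂ) :
    Matrix EA EA ℂ →ₗ[ℂ] Matrix A A ℂ :=
  (Matrix.traceLinearMap EA ℂ ℂ).smulRight σ

omit [Fintype A] [Fintype B] in
theorem applyFst_comp_replacement (N : Matrix A A ℂ →ₗ[ℂ] Matrix B B ℂ) (σ : Matrix A A ℂ)
    (M : Matrix (EA × EB) (EA × EB) ℂ) :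
    applyFst (N ∘ₗ replacement EA σ) M = N σ ⊗ₖ trFst M := by
  ext i j
  simp [applyFst, replacement, Matrix.trace, trFst, mul_comm]

theorem isChannel_replacement {σ : Matrix A A ℂ} (hσ : IsState σ) :
    IsChannel (replacement EA σ) where
  completelyPositive r M hM := by
    have h := applyFst_comp_replacement LinearMap.id σ M
    rw [LinearMap.id_comp, LinearMap.id_apply] at h
    rw [h]
    exact hσ.1.kronecker (posSemidef_trFst hM)
  tracePreserving M := by
    simp [replacement, hσ.2]

end Channels

/-! ### Attainment of the Holevo information and comparison with the assisted quantities -/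

section Holevo

variable {A B EA EB : Type*} [Fintype A] [DecidableEq A] [Fintype B] [DecidableEq B]
  [Fintype EA] [DecidableEq EA] [Fintype EB] [DecidableEq EB]

omit [DecidableEq A] in
theorem holevoQuantity_mem_holevoValues {N : Matrix A A ℂ →ₗ[ℂ] Matrix B B ℂ} (hN : IsChannel N)
    {ι : Type*} [Fintype ι] {p : ι → ℝ} (hp : p ∈ stdSimplex ℝ ι) {ρ : ι → Matrix A A ℂ}
    (hρ : ∀ x, IsState (ρ x)) : holevoQuantity p (fun x => N (ρ x)) ∈ holevoValues N := by
  let e := (Fintype.equivFin ι).symm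
  have hp' : p ∘ e ∈ stdSimplex ℝ (Fin (Fintype.card ι)) :=
    ⟨fun i => hp.1 _, (e.sum_comp p).trans hp.2⟩
  refine ⟨_, p ∘ e, ρ ∘ e, hp', fun x => hρ _, ?_⟩
  rw [mutualInfo_cqState (τ := fun x => N ((ρ ∘ e) x)) hp'.1 fun x => hN.isState (hρ _),
    holevoQuantity, holevoQuantity,
    ← e.sum_comp fun x => (p x : ℂ) • N (ρ x), ← e.sum_comp fun x => p x * entropy (N (ρ x))]
  rfl

/-- The alphabet size is unbounded, so compactness is sought elsewhere: ensembles correspond to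
convex combinations of points (ρ, S(N ρ)). Their hull is compact, and the Holevo quantity is the
continuous function S(N y₁) - y₂ on it. -/
theorem exists_isGreatest_holevoValues [Nonempty A] {N : Matrix A A ℂ →ₗ[ℂ] Matrix B B ℂ}
    (hN : IsChannel N) : ∃ v, IsGreatest (holevoValues N) v := by
  have hNc : Continuous N := LinearMap.continuous_of_finiteDimensional N
  set g : Matrix A A ℂ → Matrix A A ℂ × ℝ := fun ρ => (ρ, entropy (N ρ)) with hg
  set G := g '' {ρ | IsState ρ}
  have hNh : ∀ ρ ∈ {ρ : Matrix A A ℂ | IsState ρ}, N ρ ∈ {M : Matrix B B ℂ | M.IsHermitian} :=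
    fun ρ hρ => (hN.isState hρ).isHermitian
  have hG : IsCompact G := isCompact_setOf_isState.image_of_continuousOn
    (continuousOn_id.prodMk (continuousOn_entropy.comp hNc.continuousOn hNh))
  have hfst : ∀ {ι : Type} [Fintype ι] (p : ι → ℝ) (ρ : ι → Matrix A A ℂ),
      ∑ x, p x • g (ρ x) = (∑ x, (p x : ℂ) • ρ x, ∑ x, p x * entropy (N (ρ x))) := by
    intro ι _ p ρ
    ext1
    · simp [hg, Prod.fst_sum]
    · simp [hg, Prod.snd_sum]
  have hrep : ∀ y ∈ convexHull ℝ G, ∃ (ι : Type) (_ : Fintype ι) (p : ι → ℝ)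
      (ρ : ι → Matrix A A ℂ), p ∈ stdSimplex ℝ ι ∧ (∀ x, IsState (ρ x)) ∧
      y = (∑ x, (p x : ℂ) • ρ x, ∑ x, p x * entropy (N (ρ x))) := by
    intro y hy
    obtain ⟨ι, _, p, z, hp0, hp1, hz, rfl⟩ := mem_convexHull_iff_exists_fintype.1 hy
    choose ρ hρ hρz using hz
    exact ⟨ι, _, p, ρ, ⟨hp0, hp1⟩, hρ, by simp only [← hρz, hfst]⟩
  have hcont : ContinuousOn (fun y : Matrix A A ℂ × ℝ => entropy (N y.1) - y.2)
      (convexHull ℝ G) := by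
    refine ContinuousOn.sub (continuousOn_entropy.comp (hNc.comp continuous_fst).continuousOn ?_)
      continuousOn_snd
    intro y hy
    obtain ⟨ι, _, p, ρ, hp, hρ, rfl⟩ := hrep y hy
    exact hNh _ (IsState.sum hp hρ)
  obtain ⟨ρ₀, hρ₀⟩ := exists_isState A
  obtain ⟨y, hy, hmax⟩ := (isCompact_convexHull hG).exists_isMaxOn
    ⟨g ρ₀, subset_convexHull ℝ G ⟨ρ₀, hρ₀, rfl⟩⟩ hcont
  refine ⟨entropy (N y.1) - y.2, ?_, ?_⟩
  rotate_left
  · rintro v ⟨n, p, ρ, hp, hρ, rfl⟩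
    rw [mutualInfo_cqState hp.1 fun x => hN.isState (hρ x)]
    have h := hmax (mem_convexHull_of_exists_fintype p (fun x => g (ρ x)) hp.1 hp.2
      (fun x => ⟨_, hρ x, rfl⟩) (hfst p ρ))
    refine le_trans (le_of_eq ?_) h
    simp [holevoQuantity]
  · obtain ⟨ι, _, p, ρ, hp, hρ, rfl⟩ := hrep y hy
    have h := holevoQuantity_mem_holevoValues hN hp hρ
    convert h using 1
    simp [holevoQuantity]

omit [DecidableEq EA] [DecidableEq EB] in
theorem IsSeparableState.isState {ρ : Matrix (EA × EB) (EA × EB) ℂ} (h : IsSeparableState ρ) :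
    IsState ρ := by
  obtain ⟨n, q, α, β, hq, hα, hβ, rfl⟩ := h
  exact IsState.sum hq fun k => (hα k).kronecker (hβ k)

omit [DecidableEq A] [DecidableEq EA] in
theorem holevoValues_subset_assistedHolevoValues {N : Matrix A A ℂ →ₗ[ℂ] Matrix B B ℂ}
    (hN : IsChannel N) {ρ : Matrix (EA × EB) (EA × EB) ℂ} (hρ : IsState ρ) :
    holevoValues N ⊆ assistedHolevoValues ρ N := by
  rintro v ⟨n, p, σ, hp, hσ, rfl⟩
  refine ⟨n, p, fun x => replacement EA (σ x), hp, fun x => isChannel_replacement (hσ x), ?_⟩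
  have hs := fun x => hN.isState (hσ x)
  simp only [encodedState, applyFst_comp_replacement]
  rw [mutualInfo_cqState hp.1 hs, mutualInfo_cqState hp.1 fun x => (hs x).kronecker hρ.trFst,
    holevoQuantity_kronecker hp hs hρ.trFst]

omit [DecidableEq A] [DecidableEq EA] in
theorem holevoValues_subset_assistedMutualValues {N : Matrix A A ℂ →ₗ[ℂ] Matrix B B ℂ}
    (hN : IsChannel N) {ρ : Matrix (EA × EB) (EA × EB) ℂ} (hρ : IsState ρ) :
    holevoValues N ⊆ assistedMutualValues ρ N := by
  rintro v ⟨n, p, σ, hp, hσ, rfl⟩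
  refine ⟨n, p, fun x => replacement EA (σ x), hp, fun x => isChannel_replacement (hσ x), ?_⟩
  have hs := fun x => hN.isState (hσ x)
  simp only [encodedState, applyFst_comp_replacement]
  rw [mutualInfo_cqState hp.1 hs,
    mutualInfo_regroup_cqState hp.1 fun x => (hs x).kronecker hρ.trFst]
  simp only [trSnd_kronecker _ hρ.trFst, condEntropy_kronecker (hs _) hρ.trFst, holevoQuantity]

omit [Fintype B] [DecidableEq B] [Fintype EA] [DecidableEq EA] [Fintype EB] [DecidableEq EB] in
theorem applyFst_separable {n : ℕ} (Φ : Matrix EA EA ℂ →ₗ[ℂ] Matrix B B ℂ) (q : Fin n → ℝ)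
    (α : Fin n → Matrix EA EA ℂ) (β : Fin n → Matrix EB EB ℂ) :
    applyFst Φ (∑ k, (q k : ℂ) • (α k ⊗ₖ β k)) = ∑ k, (q k : ℂ) • (Φ (α k) ⊗ₖ β k) := by
  rw [applyFst_sum_smul]
  simp only [applyFst_kronecker]

omit [DecidableEq EA] in
omit [DecidableEq A] in
-- For each fixed `k`, the states `ℰ x (α k)` with weights `p` form an unassisted ensemble, so every
-- term of the average is at most `c`.
theorem assistedHolevoValues_le {N : Matrix A A ℂ →ₗ[ℂ] Matrix B B ℂ} (hN : IsChannel N)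
    {ρ : Matrix (EA × EB) (EA × EB) ℂ} (hρ : IsSeparableState ρ) {c : ℝ}
    (hc : c ∈ upperBounds (holevoValues N)) : c ∈ upperBounds (assistedHolevoValues ρ N) := by
  rintro v ⟨n, p, ℰ, hp, hℰ, rfl⟩
  obtain ⟨m, q, α, β, hq, hα, hβ, rfl⟩ := hρ
  have hE : ∀ x k, IsState (ℰ x (α k)) := fun x k => (hℰ x).isState (hα k)
  have hs : ∀ x k, IsState (N (ℰ x (α k))) := fun x k => hN.isState (hE x k)
  simp only [encodedState, applyFst_separable, LinearMap.comp_apply]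
  rw [mutualInfo_cqState hp.1 fun x => IsState.sum hq fun k => (hs x k).kronecker (hβ k)]
  calc _ ≤ ∑ k, q k * holevoQuantity p fun x => N (ℰ x (α k)) :=
        holevoQuantity_sum_kronecker_le hp hq hs hβ
    _ ≤ ∑ k, q k * c := Finset.sum_le_sum fun k _ => mul_le_mul_of_nonneg_left
        (hc (holevoQuantity_mem_holevoValues hN hp fun x => hE x k)) (hq.1 k)
    _ = c := by rw [← Finset.sum_mul, hq.2, one_mul]

omit [DecidableEq EA] in
omit [DecidableEq A] in
-- A single unassisted ensemble suffices here: the letters are the pairs `(x, k)`, with product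
-- weights.
theorem assistedMutualValues_le {N : Matrix A A ℂ →ₗ[ℂ] Matrix B B ℂ} (hN : IsChannel N)
    {ρ : Matrix (EA × EB) (EA × EB) ℂ} (hρ : IsSeparableState ρ) {c : ℝ}
    (hc : c ∈ upperBounds (holevoValues N)) : c ∈ upperBounds (assistedMutualValues ρ N) := by
  rintro v ⟨n, p, ℰ, hp, hℰ, rfl⟩
  obtain ⟨m, q, α, β, hq, hα, hβ, rfl⟩ := hρ
  have hE : ∀ x k, IsState (ℰ x (α k)) := fun x k => (hℰ x).isState (hα k)
  have hs : ∀ x k, IsState (N (ℰ x (α k))) := fun x k => hN.isState (hE x k)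
  simp only [encodedState, applyFst_separable, LinearMap.comp_apply]
  rw [mutualInfo_regroup_cqState hp.1
    fun x => IsState.sum hq fun k => (hs x k).kronecker (hβ k)]
  exact (entropy_sub_condEntropy_sum_kronecker_le hp hq hs hβ).trans
    (hc (holevoQuantity_mem_holevoValues hN (mul_mem_stdSimplex hp hq) fun i => hE i.1 i.2))

end Holevo

end QInfo

theorem mainTheorem11 {A B EA EB : Type*}
    [Fintype A] [DecidableEq A] [Nonempty A] [Fintype B] [DecidableEq B]
    [Fintype EA] [DecidableEq EA] [Fintype EB] [DecidableEq EB]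
    (N : Matrix A A ℂ →ₗ[ℂ] Matrix B B ℂ) (hN : QInfo.IsChannel N)
    (ρ : Matrix (EA × EB) (EA × EB) ℂ) (hρ : QInfo.IsSeparableState ρ) :
    (QInfo.assistedHolevoInfo ρ N = QInfo.assistedMutualInfo ρ N ∧
      QInfo.assistedMutualInfo ρ N = QInfo.holevoInfo N) ∧
    IsGreatest (QInfo.assistedHolevoValues ρ N) (QInfo.assistedHolevoInfo ρ N) ∧
    IsGreatest (QInfo.assistedMutualValues ρ N) (QInfo.assistedMutualInfo ρ N) ∧
    IsGreatest (QInfo.holevoValues N) (QInfo.holevoInfo N) := by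
  obtain ⟨v, hv⟩ := QInfo.exists_isGreatest_holevoValues hN
  have h₁ : IsGreatest (QInfo.assistedHolevoValues ρ N) v :=
    ⟨QInfo.holevoValues_subset_assistedHolevoValues hN hρ.isState hv.1,
      QInfo.assistedHolevoValues_le hN hρ hv.2⟩
  have h₂ : IsGreatest (QInfo.assistedMutualValues ρ N) v :=
    ⟨QInfo.holevoValues_subset_assistedMutualValues hN hρ.isState hv.1,
      QInfo.assistedMutualValues_le hN hρ hv.2⟩
  have e : QInfo.holevoInfo N = v := hv.csSup_eq
  have e₁ : QInfo.assistedHolevoInfo ρ N = v := h₁.csSup_eq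
  have e₂ : QInfo.assistedMutualInfo ρ N = v := h₂.csSup_eq
  rw [e, e₁, e₂]
  exact ⟨⟨rfl, rfl⟩, h₁, h₂, hv⟩
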